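/- **Setting.** All random variables live on one probability space $(\Omega,\mathcal A,P)$, and $m\to\infty$ throughout. Let $h:\mathbb R^2\to\mathbb R$ be measurable, let $\{Y_i\}_{i\in\mathbb Z}$ and, for each $m$, $\{Z_{i,m}\}_{i\in\mathbb Z}$ be real time series, let $\lambda>0$, $\beta\ge 0$, $k^*=\lfloor\lambda m^\beta\rfloor$, let $(c_m)$ be real thresholds, and observe $$X_{i,m}=1_{\{1\le i\le k^*+m\}}Y_i+1_{\{i>k^*+m\}}Z_{i,m},\qquad i\ge 1 .$$ (The change is early if $\beta<1$, late and linear if $\beta=1$, late and superlinear if $\beta>1$; all $\beta\ge 0$ are allowed.) With $Y$ a copy of $Y_1$ that is independent of $Y_1$ and of $Z_{1,m}$, put $\theta=\mathrm E\,h(Y,Y_1)$, $\theta_m^*=\mathrm E\,h(Y,Z_{1,m})$ (both expectations are assumed to exist and to be finite), $\Delta_m=\theta_m^*-\theta$, and $$h_1(s)=\mathrm E(h(s,Y_1)-\theta),\quad h_{1,m}^*(s)=\mathrm E(h(s,Z_{1,m})-\theta_m^*),\quad h_2(t)=\mathrm E(h(Y_1,t)-\theta),\quad h_{2,m}^*(t)=\mathrm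 E(h(Y_1,t)-\theta_m^*),$$ $$r(s,t)=h(s,t)-h_1(s)-h_2(t)-\theta,\qquad r_m^*(s,t)=h(s,t)-h_{1,m}^*(s)-h_{2,m}^*(t)-\theta_m^*,$$ $$S_{1,m}=\frac1{\sqrt m}\sum_{i=1}^m h_1(Y_i),\qquad S_{1,m}^*=\frac1{\sqrt m}\sum_{i=1}^m h_{1,m}^*(Y_i).$$ Let $\Gamma(m,k)=\frac1m\sum_{i=1}^m\sum_{j=m+1}^{m+k}(h(X_{i,m},X_{j,m})-\theta)$, $w(m,k)^{-1}=\sqrt m\,(1+k/m)$, and consider the delay time $$\kappa_m=\inf\{k>k^*: w(m,k)|\Gamma(m,k)|>c_m\}\in\mathbb N\cup\{\infty\}\qquad(\inf\emptyset=\infty).$$ **Assumptions.** "Stationary" means strictly stationary; $k_m$ denotes a sequence of non-negative integers. 1. $\Delta_m=O(1)$ and $\sqrt m|\Delta_m|/c_m\to\infty$. 2. $\{Y_i\}$ is stationary; there is $u(m)$ with $\frac{u(m)}{m^2}\log(m)^2\to0$ and $\mathrm E|\sum_{i=1}^m\sum_{j=k_1}^{k_2}r(Y_i,Y_j)|^2\le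 u(m)(k_2-k_1+1)$ for all $m+1\le k_1\le k_2$; and $\sup_{1\le k\le k_m}k_m^{-1/2}|\sum_{j=m+1}^{m+k}h_2(Y_j)|=O_P(1)$ whenever $k_m\to\infty$. 3. For each $m$, $\{X_{m+j,m}:j\ge1\}$ is independent of $(S_{1,m},S_{1,m}^*)$. 4. $\{Z_{i,m}\}_i$ is stationary for each $m$; there is $u(m)$ with $\frac{u(m)}{m^2}\log(m)^2\to0$ and $\mathrm E|\sum_{i=1}^m\sum_{j=k_1}^{k_2}r_m^*(Y_i,Z_{j,m})|^2\le u(m)(k_2-k_1+1)$ for all $m+1\le k_1\le k_2$; and for all $0\le\alpha<\frac12$ and all $l_m\to\infty$, $$\sup_{1\le l\le l_m}\frac1{l_m^{1/2-\alpha}\,l^{\alpha}}\Big|\sum_{j=m+k^*+1}^{m+k^*+l}h_{2,m}^*(Z_{j,m})\Big|=O_P(1).$$ 5. The limit $D=\lim_{m\to\infty}m^{\beta-1}\frac{\sqrt m|\Delta_m|}{c_m}\in[0,\infty]$ exists. - If $D<\infty$: for each $m$ the bivariate series $\{(Y_i,Z_{i,m})\}_i$ is stationary, and there is a centered bivariate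 Wiener process $(W,W^*)$ with $\sigma^2=\operatorname{Var}W(1)>0$ and $\sigma^{*2}=\operatorname{Var}W^*(1)>0$ (of arbitrary correlation) such that, whenever $k_m\to\infty$, $$\Big\{\frac1{\sqrt{k_m}}\sum_{j=1}^{\lfloor k_mt\rfloor}(h_2(Y_j),h_{2,m}^*(Z_{j,m})):0\le t\le1\Big\}\xrightarrow{D}\{(W(t),W^*(t)):0\le t\le1\}.$$ - If $D=\infty$: for some $\sigma>0$, whenever $k_m\to\infty$, $\frac1{\sqrt{k_m}}\sum_{j=1}^{k_m}h_2(Y_j)\xrightarrow{D}N(0,\sigma^2)$ and $\sup_{1\le l\le k_m}\frac1{\sqrt{k_m}}\sum_{j=m+k^*+1}^{m+k^*+l}h_{2,m}^*(Z_{j,m})=O_P(1)$. 6. $S_{1,m}=O_P(1)$, $S_{1,m}^*=O_P(1)$, $\liminf_{m\to\infty}c_m>0$ and $c_m\max(1,m^{1-\beta})\to\infty$. **Notation.** Let $$a_m(S_{1,m},S_{1,m}^*)=\Big(1-\frac{c_m}{\sqrt m|\Delta_m|}+\frac{S_{1,m}^*\operatorname{sign}(\Delta_m)}{\sqrt m|\Delta_m|}\Big)^{-1}\Big(k^*+k^*\frac{(S_{1,m}^*-S_{1,m})\operatorname{sign}(\Delta_m)}{\sqrt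 m|\Delta_m|}+\frac{c_m\sqrt m}{|\Delta_m|}\Big),$$ $$b_m(S_{1,m},S_{1,m}^*)=\frac{\sqrt{a_m(S_{1,m},S_{1,m}^*)}}{|\Delta_m|},\qquad \sigma_\infty^2=\begin{cases}\sigma^{*2},&D=0,\\ \frac{\lambda D}{1+\lambda D}\sigma^2+\frac1{1+\lambda D}\sigma^{*2},&0<D<\infty,\\ \sigma^2,&D=\infty.\end{cases}$$ (On events whose probability tends to $0$, on which these expressions are undefined, $a_m$ and $b_m$ may be given any values.) **Statement.** Under these assumptions, $$\frac{\kappa_m-a_m(S_{1,m},S_{1,m}^*)}{b_m(S_{1,m},S_{1,m}^*)}\xrightarrow{D}N(0,\sigma_\infty^2),$$ where the left-hand side takes the value $\infty$ if $\kappa_m=\infty$, and convergence in distribution is that of extended real random variables (in particular $P(\kappa_m=\infty)\to0$). -/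

import Mathlib

open MeasureTheory ProbabilityTheory Filter Topology Asymptotics
open scoped ENNReal NNReal UniformConvergence BoundedContinuousFunction

noncomputable section

/-! ### General probabilistic notions -/

/-- Strict stationarity of a process indexed by the integers: its law (as a law on the space of
paths) is invariant under all time shifts. -/
def IsStationarySeries {Ω E : Type*} [MeasurableSpace Ω] [MeasurableSpace E]
    (P : Measure Ω) (ξ : ℤ → Ω → E) : Prop :=
  ∀ n : ℤ, IdentDistrib (fun ω (i : ℤ) => ξ (i + n) ω) (fun ω (i : ℤ) => ξ i ω) P P

/-- The relation `V m = O_P(1)` as `m → ∞`. -/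
def IsBoundedInProbability {Ω : Type*} [MeasurableSpace Ω] (P : Measure Ω)
    (V : ℕ → Ω → ℝ) : Prop :=
  ∀ ε : ℝ, 0 < ε → ∃ C : ℝ, ∀ᶠ m in atTop, P.real {ω | C < |V m ω|} ≤ ε

/-- The maximum of `f 1, …, f n` (and `0` for `n = 0`). -/
def maxUpTo (n : ℕ) (f : ℕ → ℝ) : ℝ :=
  sSup (f '' Set.Icc 1 n)

/-- A centered bivariate Wiener process on `[0, 1]` whose value at time `1` has covariance matrix
`!![σ ^ 2, ρ; ρ, τ ^ 2]`: it starts in `0`, has independent increments, the increment over `[s, t]`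
is centered Gaussian with covariance matrix `(t - s) • !![σ ^ 2, ρ; ρ, τ ^ 2]`, and its paths are
almost surely continuous. (A law on `ℝ × ℝ` is Gaussian with a given covariance matrix iff all
linear combinations of its coordinates are Gaussian with the corresponding variances.) -/
structure IsBivariateWiener {Ω' : Type*} [MeasurableSpace Ω'] (W : unitInterval → Ω' → ℝ × ℝ)
    (σ τ ρ : ℝ) (P' : Measure Ω') : Prop where
  start_zero : ∀ᵐ ω ∂P', W 0 ω = 0
  indep_increments : HasIndepIncrements W P'
  gaussian_increments : ∀ s t : unitInterval, s ≤ t → ∀ a b : ℝ,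
    HasLaw (fun ω => a * ((W t ω).1 - (W s ω).1) + b * ((W t ω).2 - (W s ω).2))
      (gaussianReal 0
        (((t : ℝ) - (s : ℝ)) * (a ^ 2 * σ ^ 2 + 2 * a * b * ρ + b ^ 2 * τ ^ 2)).toNNReal) P'
  continuous_paths : ∀ᵐ ω ∂P', Continuous fun t => W t ω

/-- The normalized partial sum path `t ↦ n ^ (-1/2) * ∑_{1 ≤ j ≤ ⌊n t⌋} ξ j`, `0 ≤ t ≤ 1`. -/
def partialSumPath {Ω : Type*} (ξ : ℕ → Ω → ℝ × ℝ) (n : ℕ) (ω : Ω) : unitInterval →ᵤ ℝ × ℝ :=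
  UniformFun.ofFun fun t =>
    (1 / √(n : ℝ)) • ∑ j ∈ Finset.Icc 1 ⌊(n : ℝ) * (t : ℝ)⌋₊, ξ j ω

/-- The functional central limit theorem for a triangular array `ξ m j` of bivariate random vectors:
for all `k m → ∞` the partial sum paths of length `k m` of the row `m` converge in distribution to
a centered bivariate Wiener process whose coordinates have the variances `σ ^ 2` and `τ ^ 2` at
time `1`. Convergence in distribution of paths is tested on all bounded functionals that are
continuous for the supremum norm; as the limit has continuous paths (and the partial sum paths take
their values in a finite dimensional space for each fixed `k m`), this is the same as weak
convergence for the Skorokhod topology. -/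
def FunctionalCLT {Ω : Type*} [MeasurableSpace Ω] (P : Measure Ω)
    (ξ : ℕ → ℕ → Ω → ℝ × ℝ) (σ τ : ℝ) : Prop :=
  ∃ (Ω' : Type) (_ : MeasurableSpace Ω') (P' : Measure Ω') (_ : IsProbabilityMeasure P')
    (W : unitInterval → Ω' → ℝ × ℝ) (ρ : ℝ),
    IsBivariateWiener W σ τ ρ P' ∧
      ∀ k : ℕ → ℕ, Tendsto k atTop atTop →
        ∀ F : (unitInterval →ᵤ ℝ × ℝ) →ᵇ ℝ,
          Tendsto (fun m => ∫ ω, F (partialSumPath (ξ m) (k m) ω) ∂P) atTop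
            (𝓝 (∫ ω, F (UniformFun.ofFun fun t => W t ω) ∂P'))

/-! ### The change point model -/

/-- The data of the monitoring problem: the kernel `h`, the series `Y i` before the change, the
series `Z m i` after the change (for a historic sample of length `m`), the parameters `lam > 0` and
`beta ≥ 0` of the change point `⌊lam * m ^ beta⌋`, and the thresholds `c m`. -/
structure MonitoringModel (Ω : Type*) [MeasurableSpace Ω] where
  h : ℝ → ℝ → ℝ
  measurable_h : Measurable (Function.uncurry h)
  Y : ℤ → Ω → ℝ
  measurable_Y : ∀ i, Measurable (Y i)
  Z : ℕ → ℤ → Ω → ℝ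
  measurable_Z : ∀ m i, Measurable (Z m i)
  lam : ℝ
  lam_pos : 0 < lam
  beta : ℝ
  beta_nonneg : 0 ≤ beta
  c : ℕ → ℝ

namespace MonitoringModel

variable {Ω : Type*} [MeasurableSpace Ω] (M : MonitoringModel Ω) (P : Measure Ω)

/-- The change point `k* = ⌊lam * m ^ beta⌋`. -/
def kstar (m : ℕ) : ℕ := ⌊M.lam * (m : ℝ) ^ M.beta⌋₊

/-- The observations: `Y i` up to time `k* + m`, and `Z m i` afterwards. -/
def X (m : ℕ) (i : ℕ) (ω : Ω) : ℝ :=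
  if i ≤ M.kstar m + m then M.Y i ω else M.Z m i ω

/-- `θ = E h(Y, Y₁)` with an independent copy `Y` of `Y₁`. -/
def theta : ℝ := ∫ z, M.h z.1 z.2 ∂((P.map (M.Y 1)).prod (P.map (M.Y 1)))

/-- `θ*_m = E h(Y, Z_{1,m})` with a copy `Y` of `Y₁` that is independent of `Z_{1,m}`. -/
def thetaStar (m : ℕ) : ℝ := ∫ z, M.h z.1 z.2 ∂((P.map (M.Y 1)).prod (P.map (M.Z m 1)))

/-- The magnitude of the change. -/
def Delta (m : ℕ) : ℝ := M.thetaStar P m - M.theta P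

def h1 (s : ℝ) : ℝ := ∫ ω, (M.h s (M.Y 1 ω) - M.theta P) ∂P

def h1Star (m : ℕ) (s : ℝ) : ℝ := ∫ ω, (M.h s (M.Z m 1 ω) - M.thetaStar P m) ∂P

def h2 (t : ℝ) : ℝ := ∫ ω, (M.h (M.Y 1 ω) t - M.theta P) ∂P

def h2Star (m : ℕ) (t : ℝ) : ℝ := ∫ ω, (M.h (M.Y 1 ω) t - M.thetaStar P m) ∂P

def r (s t : ℝ) : ℝ := M.h s t - M.h1 P s - M.h2 P t - M.theta P

def rStar (m : ℕ) (s t : ℝ) : ℝ := M.h s t - M.h1Star P m s - M.h2Star P m t - M.thetaStar P m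

/-- `S_{1,m}`. -/
def S1 (m : ℕ) (ω : Ω) : ℝ := 1 / √(m : ℝ) * ∑ i ∈ Finset.Icc 1 m, M.h1 P (M.Y i ω)

/-- `S*_{1,m}`. -/
def S1Star (m : ℕ) (ω : Ω) : ℝ := 1 / √(m : ℝ) * ∑ i ∈ Finset.Icc 1 m, M.h1Star P m (M.Y i ω)

/-- The monitoring statistic `Γ(m, k)`. -/
def Gam (m k : ℕ) (ω : Ω) : ℝ :=
  1 / (m : ℝ) * ∑ i ∈ Finset.Icc 1 m, ∑ j ∈ Finset.Icc (m + 1) (m + k),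
    (M.h (M.X m i ω) (M.X m j ω) - M.theta P)

/-- The weight function, `w(m, k)⁻¹ = m ^ (1/2) * (1 + k / m)`. -/
def weight (m k : ℕ) : ℝ := (√(m : ℝ) * (1 + (k : ℝ) / (m : ℝ)))⁻¹

/-- The delay time `κ_m = inf {k > k* : w(m, k) |Γ(m, k)| > c_m}`, with `inf ∅ = ∞`. -/
def delayTime (m : ℕ) (ω : Ω) : ℕ∞ :=
  ⨅ (k : ℕ) (_ : M.kstar m < k ∧ M.c m < weight m k * |M.Gam P m k ω|), (k : ℕ∞)

/-- The centering sequence `a_m(s, s*)`. -/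
def a (m : ℕ) (s sStar : ℝ) : ℝ :=
  (1 - M.c m / (√(m : ℝ) * |M.Delta P m|)
      + sStar * Real.sign (M.Delta P m) / (√(m : ℝ) * |M.Delta P m|))⁻¹
    * ((M.kstar m : ℝ)
      + (M.kstar m : ℝ) * ((sStar - s) * Real.sign (M.Delta P m) / (√(m : ℝ) * |M.Delta P m|))
      + M.c m * √(m : ℝ) / |M.Delta P m|)

/-- The scaling sequence `b_m(s, s*)`. -/
def b (m : ℕ) (s sStar : ℝ) : ℝ := √(M.a P m s sStar) / |M.Delta P m|

/-- The standardized delay time `(κ_m - a_m(S_{1,m}, S*_{1,m})) / b_m(S_{1,m}, S*_{1,m})`, an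
extended real random variable with the value `∞` where `κ_m = ∞`. -/
def standardizedDelay (m : ℕ) (ω : Ω) : EReal :=
  if M.delayTime P m ω = ⊤ then ⊤
  else ((((M.delayTime P m ω).toNat : ℝ) - M.a P m (M.S1 P m ω) (M.S1Star P m ω))
    / M.b P m (M.S1 P m ω) (M.S1Star P m ω) : ℝ)

/-- The limit variance `σ_∞ ^ 2`, where `D ∈ [0, ∞]` is the limit of
`m ^ (beta - 1) * √m * |Δ_m| / c_m`, and `σ ^ 2`, `τ ^ 2` are the long run variances of the
monitoring sample before and after the change. -/
def limitVariance (σ τ : ℝ) (D : ℝ≥0∞) : ℝ :=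
  if D = 0 then τ ^ 2
  else if D = ⊤ then σ ^ 2
  else M.lam * D.toReal / (1 + M.lam * D.toReal) * σ ^ 2 + 1 / (1 + M.lam * D.toReal) * τ ^ 2

/-! ### The assumptions -/

/-- Both expectations that define the magnitude of the change exist. -/
structure KernelIntegrable : Prop where
  before : Integrable (Function.uncurry M.h) ((P.map (M.Y 1)).prod (P.map (M.Y 1)))
  after : ∀ m, Integrable (Function.uncurry M.h) ((P.map (M.Y 1)).prod (P.map (M.Z m 1)))

/-- The change is bounded, but asymptotically detectable. -/
structure ChangeMagnitude : Prop where
  bounded : (fun m => M.Delta P m) =O[atTop] (fun _ => (1 : ℝ))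
  detectable : Tendsto (fun m : ℕ => √(m : ℝ) * |M.Delta P m| / M.c m) atTop atTop

/-- The assumptions on the series before the change. -/
structure BeforeChange : Prop where
  stationary : IsStationarySeries P M.Y
  remainder : ∃ u : ℕ → ℝ,
    (∀ m k₁ k₂ : ℕ, m + 1 ≤ k₁ → k₁ ≤ k₂ →
      ∫⁻ ω, ENNReal.ofReal
          (|∑ i ∈ Finset.Icc 1 m, ∑ j ∈ Finset.Icc k₁ k₂, M.r P (M.Y i ω) (M.Y j ω)| ^ 2) ∂P
        ≤ ENNReal.ofReal (u m * ((k₂ : ℝ) - (k₁ : ℝ) + 1))) ∧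
    Tendsto (fun m : ℕ => u m / (m : ℝ) ^ 2 * Real.log (m : ℝ) ^ 2) atTop (𝓝 0)
  partial_sums : ∀ k : ℕ → ℕ, Tendsto k atTop atTop →
    IsBoundedInProbability P fun m ω => maxUpTo (k m) fun l =>
      1 / √(k m : ℝ) * |∑ j ∈ Finset.Icc (m + 1) (m + l), M.h2 P (M.Y j ω)|

/-- The monitoring sample is independent of `(S_{1,m}, S*_{1,m})`. -/
def MonitoringIndependent : Prop :=
  ∀ m : ℕ, IndepFun (fun ω (j : ℕ) => M.X m (m + 1 + j) ω)
    (fun ω => (M.S1 P m ω, M.S1Star P m ω)) P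

/-- The assumptions on the series after the change. -/
structure AfterChange : Prop where
  stationary : ∀ m, IsStationarySeries P (M.Z m)
  remainder : ∃ u : ℕ → ℝ,
    (∀ m k₁ k₂ : ℕ, m + 1 ≤ k₁ → k₁ ≤ k₂ →
      ∫⁻ ω, ENNReal.ofReal
          (|∑ i ∈ Finset.Icc 1 m, ∑ j ∈ Finset.Icc k₁ k₂, M.rStar P m (M.Y i ω) (M.Z m j ω)| ^ 2)
          ∂P
        ≤ ENNReal.ofReal (u m * ((k₂ : ℝ) - (k₁ : ℝ) + 1))) ∧
    Tendsto (fun m : ℕ => u m / (m : ℝ) ^ 2 * Real.log (m : ℝ) ^ 2) atTop (𝓝 0)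
  hajek_renyi : ∀ α : ℝ, 0 ≤ α → α < 1 / 2 → ∀ k : ℕ → ℕ, Tendsto k atTop atTop →
    IsBoundedInProbability P fun m ω => maxUpTo (k m) fun l =>
      1 / ((k m : ℝ) ^ (1 / 2 - α) * (l : ℝ) ^ α) *
        |∑ j ∈ Finset.Icc (m + M.kstar m + 1) (m + M.kstar m + l), M.h2Star P m (M.Z m j ω)|

/-- The additional assumptions for very early changes: the bivariate series `(Y i, Z m i)` is
stationary and satisfies a functional central limit theorem. -/
structure VeryEarlyChange (σ τ : ℝ) : Prop where
  sigma_pos : 0 < σ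
  tau_pos : 0 < τ
  jointly_stationary : ∀ m, IsStationarySeries P fun (i : ℤ) ω => (M.Y i ω, M.Z m i ω)
  fclt : FunctionalCLT P (fun m j ω => (M.h2 P (M.Y j ω), M.h2Star P m (M.Z m j ω))) σ τ

/-- The additional assumptions for later changes. -/
structure LaterChange [IsProbabilityMeasure P] (σ : ℝ) : Prop where
  sigma_pos : 0 < σ
  clt : ∀ k : ℕ → ℕ, Tendsto k atTop atTop →
    TendstoInDistribution
      (fun (m : ℕ) ω => 1 / √(k m : ℝ) * ∑ j ∈ Finset.Icc 1 (k m), M.h2 P (M.Y j ω))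
      atTop (id : ℝ → ℝ) (fun _ => P) (gaussianReal 0 (σ ^ 2).toNNReal)
  partial_sums : ∀ k : ℕ → ℕ, Tendsto k atTop atTop →
    IsBoundedInProbability P fun m ω => maxUpTo (k m) fun l =>
      1 / √(k m : ℝ) *
        ∑ j ∈ Finset.Icc (m + M.kstar m + 1) (m + M.kstar m + l), M.h2Star P m (M.Z m j ω)

/-- The assumptions on the thresholds and on the historic sample. -/
structure ThresholdAssumptions : Prop where
  S1_bounded : IsBoundedInProbability P (M.S1 P)
  S1Star_bounded : IsBoundedInProbability P (M.S1Star P)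
  liminf_pos : ∃ c₀ : ℝ, 0 < c₀ ∧ ∀ᶠ m in atTop, c₀ ≤ M.c m
  diverges : Tendsto (fun m : ℕ => M.c m * max 1 ((m : ℝ) ^ (1 - M.beta))) atTop atTop

end MonitoringModel

end

/-!
The proof rests on an exact identity. Write `d = |Δ_m|`, `s = sign Δ_m`, `ρ = √m`. After the change
point the Hoeffding decomposition of the kernel writes the signed detector `s * Γ(m, k)` minus the
boundary `c_m * (ρ + k / ρ)` as

  `q * d * (k - a_m) + s * N(k)`,

where `a_m = a_m(S_{1,m}, S*_{1,m})` is exactly the centering sequence of the theorem,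
`q = 1 - c_m / (ρ * d) + s * S*_{1,m} / (ρ * d)` tends to `1` in probability, and the noise `N(k)`
consists of the partial sums of `h₂(Y_j)` before and of `h*₂(Z_j)` after the change, and of the
remainder of the decomposition (`MonitoringModel.Gam_eq_detectorPath`,
`RegularPath.mul_detectorPath_sub`). Thus the delay time is the first passage of a line with slope
`d`, perturbed by noise of the order `√a_m`, over zero. On a window around `a_m` of length `o(a_m)`
the noise is constant up to `o(√a_m)`. Hence the passage happens at `a_m - s * N(a_m) / d`, up to
`o(√a_m / d)`, which is the claim as soon as `N(a_m) / √a_m` is asymptotically normal. Before the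
window, the drift is too negative for an upcrossing, and the boundary is too high for a crossing by
`-s * Γ`, since it dominates the noise already at the change point. This pathwise argument is
`RegularPath.exists_first_crossing`.

The random center `a_m` is asymptotically equivalent to the deterministic `k* + c_m * ρ / d`
(`MonitoringModel.approxDelay`). Therefore the noise can be evaluated at a deterministic time,
although `a_m` depends on the historic sample.

The probabilistic inputs are the following. By stationarity the assumed bounds for maximal partial
sums hold for every starting point, so that partial sums over windows of length `o(ν)` are uniformly
`o_P(√ν)` (`tendsto_measureReal_max_window`). The remainder is negligible by the maximal inequality
of Rademacher and Menshov (`measureReal_max_sum_le`); its logarithmic factor is harmless because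
`approxDelay` grows polynomially in `m`. For the asymptotic normality of the noise, let `t` be the
limit of `k* / approxDelay`. If `D = ∞` then `t = 1` and only the observations before the change
contribute. If `D < ∞` then `t = lam * D / (1 + lam * D)`, and the noise is close to the continuous
functional `f ↦ f₁(t) + f₂(1) - f₂(t)` of the bivariate partial sum path, whose limit is normal
with variance `t * σ ^ 2 + (1 - t) * τ ^ 2`.
-/

noncomputable section

/-! ### The maximal inequality of Rademacher and Menshov -/

lemma sum_range_two_mul (f : ℕ → ℝ) (n : ℕ) :
    ∑ t ∈ Finset.range (2 * n), f t = ∑ t ∈ Finset.range n, (f (2 * t) + f (2 * t + 1)) := by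
  induction n with
  | zero => simp
  | succ n ih =>
    rw [show 2 * (n + 1) = 2 * n + 1 + 1 by ring, Finset.sum_range_succ, Finset.sum_range_succ, ih,
      Finset.sum_range_succ]
    ring

/-- The `ℓ²`-norm of the sums over the dyadic blocks of length `2 ^ i` in `{0, …, 2 ^ p - 1}`. -/
def dyadicNorm (x : ℕ → ℝ) (p i : ℕ) : ℝ :=
  √(∑ j ∈ Finset.range (2 ^ (p - i)), (∑ t ∈ Finset.range (2 ^ i), x (j * 2 ^ i + t)) ^ 2)

lemma dyadicNorm_pair (x : ℕ → ℝ) (p i : ℕ) :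
    dyadicNorm (fun j => x (2 * j) + x (2 * j + 1)) p i = dyadicNorm x (p + 1) (i + 1) := by
  unfold dyadicNorm
  rw [Nat.add_sub_add_right]
  congr 1
  refine Finset.sum_congr rfl fun j _ => ?_
  rw [pow_succ 2 i, mul_comm (2 ^ i) 2, sum_range_two_mul]
  congr 1
  refine Finset.sum_congr rfl fun t _ => ?_
  simp only [show 2 * (j * 2 ^ i + t) = j * (2 * 2 ^ i) + 2 * t by ring]
  rfl

/-- Every partial sum is a sum of dyadic blocks of pairwise different lengths. -/
lemma abs_sum_range_le_dyadicNorm (p : ℕ) : ∀ (x : ℕ → ℝ) (l : ℕ), l ≤ 2 ^ p →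
    |∑ j ∈ Finset.range l, x j| ≤ ∑ i ∈ Finset.range (p + 1), dyadicNorm x p i := by
  induction p with
  | zero =>
    intro x l hl
    have : l = 0 ∨ l = 1 := by simp at hl; omega
    rcases this with rfl | rfl
    · simp [dyadicNorm]
    · simp [dyadicNorm, Real.sqrt_sq_eq_abs]
  | succ p ih =>
    intro x l hl
    rw [Finset.sum_range_succ' _ (p + 1)]
    have h1 := ih (fun j => x (2 * j) + x (2 * j + 1)) (l / 2) (by rw [pow_succ] at hl; omega)
    simp_rw [dyadicNorm_pair] at h1
    rw [← sum_range_two_mul] at h1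
    have hnn : 0 ≤ dyadicNorm x (p + 1) 0 := Real.sqrt_nonneg _
    rcases Nat.mod_two_eq_zero_or_one l with h | h
    · have : 2 * (l / 2) = l := by omega
      rw [this] at h1
      linarith
    · have h2 : 2 * (l / 2) + 1 = l := by omega
      rw [← h2, Finset.sum_range_succ]
      refine (abs_add_le _ _).trans (add_le_add h1 ?_)
      have h3 : x (2 * (l / 2)) ^ 2 ≤ ∑ j ∈ Finset.range (2 ^ (p + 1)), x j ^ 2 :=
        Finset.single_le_sum (f := fun j => x j ^ 2) (fun j _ => sq_nonneg _)
          (Finset.mem_range.2 (by omega))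
      unfold dyadicNorm
      rw [← Real.sqrt_sq_eq_abs]
      exact Real.sqrt_le_sqrt (by simpa using h3)

section PartialSums

variable {Ω : Type*} [MeasurableSpace Ω] {P : Measure Ω}

/-- If the variances of the block sums grow linearly in the block length, then the maximum of the
first `2 ^ p` partial sums has a second moment of the order `(p + 1) ^ 2 * 2 ^ p`. -/
lemma measureReal_max_sum_le [IsProbabilityMeasure P] {x : ℕ → Ω → ℝ} (hx : ∀ j, Measurable (x j))
    {u : ℝ} (hu : 0 ≤ u)
    (hmom : ∀ a n : ℕ, ∫⁻ ω, ENNReal.ofReal ((∑ t ∈ Finset.range n, x (a + t) ω) ^ 2) ∂P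
      ≤ ENNReal.ofReal (u * n)) (p : ℕ) {c : ℝ} (hc : 0 < c) :
    P.real {ω | ∃ l ≤ 2 ^ p, c < |∑ j ∈ Finset.range l, x j ω|}
      ≤ ((p : ℝ) + 1) ^ 2 * u * 2 ^ p / c ^ 2 := by
  set G : Ω → ℝ≥0∞ := fun ω => ∑ i ∈ Finset.range (p + 1), ∑ j ∈ Finset.range (2 ^ (p - i)),
    ENNReal.ofReal ((∑ t ∈ Finset.range (2 ^ i), x (j * 2 ^ i + t) ω) ^ 2) with hG
  have hGm : Measurable G := by
    refine Finset.measurable_sum _ fun i _ => Finset.measurable_sum _ fun j _ => ?_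
    refine ENNReal.measurable_ofReal.comp (Measurable.pow_const ?_ 2)
    exact Finset.measurable_sum _ fun t _ => hx _
  have hint : ∫⁻ ω, G ω ∂P ≤ ENNReal.ofReal (((p : ℝ) + 1) * (u * 2 ^ p)) := by
    rw [hG, lintegral_finsetSum]
    swap
    · exact fun i _ => Finset.measurable_sum _ fun j _ => ENNReal.measurable_ofReal.comp
        (Measurable.pow_const (Finset.measurable_sum _ fun t _ => hx _) 2)
    calc _ ≤ ∑ i ∈ Finset.range (p + 1), ENNReal.ofReal (u * 2 ^ p) := by
          refine Finset.sum_le_sum fun i hi => ?_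
          rw [lintegral_finsetSum]
          swap
          · exact fun j _ => ENNReal.measurable_ofReal.comp
              (Measurable.pow_const (Finset.measurable_sum _ fun t _ => hx _) 2)
          refine (Finset.sum_le_sum fun j _ => hmom (j * 2 ^ i) (2 ^ i)).trans ?_
          rw [Finset.sum_const, Finset.card_range, ← ENNReal.ofReal_nsmul]
          refine ENNReal.ofReal_le_ofReal (le_of_eq ?_)
          have : p = (p - i) + i := by have := Finset.mem_range.1 hi; omega
          conv_rhs => rw [this]
          simp only [nsmul_eq_mul]
          push_cast
          rw [pow_add]
          ring
      _ = _ := by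
          rw [Finset.sum_const, Finset.card_range, ← ENNReal.ofReal_nsmul]
          simp
  have hsub : {ω | ∃ l ≤ 2 ^ p, c < |∑ j ∈ Finset.range l, x j ω|}
      ⊆ {ω | ENNReal.ofReal (c ^ 2 / (p + 1)) ≤ G ω} := by
    rintro ω ⟨l, hl, hlt⟩
    have h1 := hlt.le.trans (abs_sum_range_le_dyadicNorm p (fun j => x j ω) l hl)
    have h2 : c ^ 2 ≤ ((p : ℝ) + 1) * ∑ i ∈ Finset.range (p + 1),
        dyadicNorm (fun j => x j ω) p i ^ 2 := by
      refine (pow_le_pow_left₀ hc.le h1 2).trans ?_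
      have := sq_sum_le_card_mul_sum_sq (s := Finset.range (p + 1))
        (f := fun i => dyadicNorm (fun j => x j ω) p i)
      simpa using this
    have h3 : G ω = ENNReal.ofReal (∑ i ∈ Finset.range (p + 1),
        dyadicNorm (fun j => x j ω) p i ^ 2) := by
      rw [ENNReal.ofReal_sum_of_nonneg fun i _ => sq_nonneg _]
      refine Finset.sum_congr rfl fun i _ => ?_
      rw [dyadicNorm, Real.sq_sqrt (Finset.sum_nonneg fun j _ => sq_nonneg _),
        ENNReal.ofReal_sum_of_nonneg fun j _ => sq_nonneg _]
    simp only [Set.mem_ofPred_eq, h3]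
    refine ENNReal.ofReal_le_ofReal ?_
    rw [div_le_iff₀ (by positivity)]
    linarith
  have hM := mul_meas_ge_le_lintegral (μ := P) hGm (ENNReal.ofReal (c ^ 2 / (p + 1)))
  have hM2 := hM.trans hint
  rw [← ofReal_measureReal (by finiteness), ← ENNReal.ofReal_mul (by positivity),
    ENNReal.ofReal_le_ofReal_iff (by positivity)] at hM2
  refine (measureReal_mono hsub).trans ?_
  rw [le_div_iff₀ (by positivity)]
  have hp : (0 : ℝ) < p + 1 := by positivity
  rw [div_mul_eq_mul_div, div_le_iff₀ hp] at hM2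
  nlinarith [hM2]

/-! ### Boundedness in probability of partial sums -/

lemma sum_Icc_add (f : ℕ → ℝ) (p l : ℕ) :
    ∑ j ∈ Finset.Icc (p + 1) (p + l), f j = ∑ i ∈ Finset.range l, f (p + 1 + i) := by
  have : Finset.Icc (p + 1) (p + l) = Finset.Ico (p + 1) (p + l + 1) := by
    ext; simp only [Finset.mem_Icc, Finset.mem_Ico]; omega
  rw [this, Finset.sum_Ico_eq_sum_range]
  congr 2; omega

lemma sum_Icc_add_add (f : ℕ → ℝ) (p a l : ℕ) :
    ∑ j ∈ Finset.Icc (p + 1) (p + a + l), f j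
      = ∑ j ∈ Finset.Icc (p + 1) (p + a), f j
        + ∑ j ∈ Finset.Icc (p + a + 1) (p + a + l), f j := by
  rw [add_assoc, sum_Icc_add, sum_Icc_add, ← add_assoc, sum_Icc_add, Finset.sum_range_add]
  congr 1
  refine Finset.sum_congr rfl fun i _ => ?_
  congr 1
  omega

lemma le_maxUpTo {n l : ℕ} (f : ℕ → ℝ) (h1 : 1 ≤ l) (hl : l ≤ n) : f l ≤ maxUpTo n f :=
  le_csSup ((Set.finite_Icc 1 n).image f).bddAbove (Set.mem_image_of_mem f ⟨h1, hl⟩)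

/-- Bounds in probability for maxima of partial sums do not depend on the starting point of the
sums, if the series is stationary. -/
lemma measureReal_max_sum_shift {E : Type*} [MeasurableSpace E] {ξ : ℤ → Ω → E}
    (hst : IsStationarySeries P ξ) {g : E → ℝ} (hg : Measurable g) (p q n : ℕ) (c : ℝ) :
    P.real {ω | ∃ l ≤ n, c < |∑ j ∈ Finset.Icc (p + 1) (p + l), g (ξ (j : ℤ) ω)|}
      = P.real {ω | ∃ l ≤ n, c < |∑ j ∈ Finset.Icc (q + 1) (q + l), g (ξ (j : ℤ) ω)|} := by
  have hB : MeasurableSet {x : ℤ → E | ∃ l ≤ n,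
      c < |∑ i ∈ Finset.range l, g (x ((q + 1 + i : ℕ) : ℤ))|} := by
    have : {x : ℤ → E | ∃ l ≤ n, c < |∑ i ∈ Finset.range l, g (x ((q + 1 + i : ℕ) : ℤ))|}
        = ⋃ l ∈ Set.Iic n,
          {x : ℤ → E | c < |∑ i ∈ Finset.range l, g (x ((q + 1 + i : ℕ) : ℤ))|} := by
      ext; simp
    rw [this]
    refine MeasurableSet.biUnion (Set.to_countable _) fun l _ =>
      measurableSet_lt measurable_const ?_
    refine Measurable.abs (Finset.measurable_sum _ fun i _ => hg.comp (measurable_pi_apply _))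
  have h := (hst ((p : ℤ) - q)).measure_mem_eq hB
  simp only [sum_Icc_add]
  rw [measureReal_def, measureReal_def]
  congr 1
  refine Eq.trans (congrArg P ?_) h
  ext ω
  simp only [Set.mem_ofPred_eq, Set.mem_preimage]
  refine exists_congr fun l => and_congr_right fun _ => ?_
  rw [Finset.sum_congr rfl fun i _ => ?_]
  congr 2
  push_cast
  ring

/-- The assumption on maxima of normalized partial sums, in terms of the events that some partial
sum is large. -/
lemma IsBoundedInProbability.measureReal_max_sum_le [IsProbabilityMeasure P] {S : ℕ → ℕ → Ω → ℝ}
    {k : ℕ → ℕ} (hk : Tendsto k atTop atTop) (hS0 : ∀ m ω, S m 0 ω = 0)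
    (h : IsBoundedInProbability P fun m ω => maxUpTo (k m) fun l => 1 / √(k m : ℝ) * |S m l ω|)
    {ε : ℝ} (hε : 0 < ε) :
    ∃ C : ℝ, 0 < C ∧ ∀ᶠ m in atTop, P.real {ω | ∃ l ≤ k m, C * √(k m : ℝ) < |S m l ω|} ≤ ε := by
  obtain ⟨C, hC⟩ := h ε hε
  refine ⟨max C 1, by positivity, ?_⟩
  filter_upwards [hC, hk.eventually_gt_atTop 0] with m hm hkm
  refine (measureReal_mono ?_).trans hm
  rintro ω ⟨l, hl, hlt⟩
  have hk0 : 0 < √(k m : ℝ) := Real.sqrt_pos.2 (by exact_mod_cast hkm)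
  have hl1 : 1 ≤ l := by
    by_contra h0
    have : l = 0 := by omega
    subst this
    rw [hS0, abs_zero] at hlt
    have : 0 < max C 1 * √(k m : ℝ) := by positivity
    linarith
  have h1 := le_maxUpTo (fun l => 1 / √(k m : ℝ) * |S m l ω|) hl1 hl
  refine lt_of_lt_of_le ?_ (h1.trans (le_abs_self _))
  rw [one_div, inv_mul_eq_div, lt_div_iff₀ hk0]
  exact lt_of_le_of_lt (mul_le_mul_of_nonneg_right (le_max_left _ _) hk0.le) hlt

/-- Partial sums of a stationary series over a window of length `n m = o(ν m)` are uniformly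
`o_P(√(ν m))`, wherever the window starts. -/
lemma tendsto_measureReal_max_window [IsProbabilityMeasure P] {E : Type*} [MeasurableSpace E]
    {ξ : ℕ → ℤ → Ω → E} (hst : ∀ m, IsStationarySeries P (ξ m)) {g : ℕ → E → ℝ}
    (hg : ∀ m, Measurable (g m)) {q : ℕ → ℕ}
    (hb : ∀ k : ℕ → ℕ, Tendsto k atTop atTop → IsBoundedInProbability P fun m ω =>
      maxUpTo (k m) fun l => 1 / √(k m : ℝ) *
        |∑ j ∈ Finset.Icc (q m + 1) (q m + l), g m (ξ m (j : ℤ) ω)|)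
    (p : ℕ → ℕ) {n : ℕ → ℕ} {ν : ℕ → ℝ} (hν : Tendsto ν atTop atTop)
    (hn : Tendsto (fun m => (n m : ℝ) / ν m) atTop (𝓝 0)) {ε : ℝ} (hε : 0 < ε) :
    Tendsto (fun m => P.real {ω | ∃ l ≤ n m, ε * √(ν m) <
      |∑ j ∈ Finset.Icc (p m + 1) (p m + l), g m (ξ m (j : ℤ) ω)|}) atTop (𝓝 0) := by
  -- the maximal inequality needs window lengths that tend to infinity, which `n` need not do
  set k : ℕ → ℕ := fun m => n m + ⌈√(ν m)⌉₊ with hk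
  have hsq : Tendsto (fun m => √(ν m)) atTop atTop := Real.tendsto_sqrt_atTop.comp hν
  have hkt : Tendsto k atTop atTop :=
    tendsto_atTop_mono (fun m => Nat.le_add_left _ _) (tendsto_nat_ceil_atTop.comp hsq)
  have hkν : Tendsto (fun m => (k m : ℝ) / ν m) atTop (𝓝 0) := by
    have h1 : Tendsto (fun m => (n m : ℝ) / ν m + ((√(ν m))⁻¹ + (ν m)⁻¹)) atTop (𝓝 0) := by
      simpa using hn.add ((tendsto_inv_atTop_zero.comp hsq).add (tendsto_inv_atTop_zero.comp hν))
    refine tendsto_of_tendsto_of_tendsto_of_le_of_le' tendsto_const_nhds h1 ?_ ?_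
    · filter_upwards [hν.eventually_gt_atTop 0] with m hm
      positivity
    · filter_upwards [hν.eventually_gt_atTop 0] with m hm
      have h2 := (Nat.ceil_lt_add_one (Real.sqrt_nonneg (ν m))).le
      have h3 : (√(ν m))⁻¹ = √(ν m) / ν m := by
        rw [Real.sqrt_div_self]
      rw [h3, ← one_div, ← add_div, ← add_div]
      simp only [hk]
      push_cast
      gcongr
  rw [Metric.tendsto_atTop]
  intro η hη
  obtain ⟨C, hC0, hC⟩ := (hb k hkt).measureReal_max_sum_le hkt (by simp) (half_pos hη)
  have h4 : ∀ᶠ m in atTop, (k m : ℝ) / ν m < (ε / C) ^ 2 :=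
    hkν.eventually (gt_mem_nhds (by positivity))
  rw [← eventually_atTop]
  filter_upwards [hC, h4, hν.eventually_gt_atTop 0] with m hm hm4 hν0
  rw [Real.dist_eq, sub_zero, abs_of_nonneg measureReal_nonneg,
    measureReal_max_sum_shift (hst m) (hg m) (p m) (q m)]
  refine lt_of_le_of_lt ((measureReal_mono ?_).trans hm) (half_lt_self hη)
  rintro ω ⟨l, hl, hlt⟩
  refine ⟨l, hl.trans (Nat.le_add_right _ _), lt_of_le_of_lt ?_ hlt⟩
  rw [div_lt_iff₀ hν0] at hm4
  have h5 := Real.sqrt_le_sqrt hm4.le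
  rw [Real.sqrt_mul (by positivity), Real.sqrt_sq (by positivity)] at h5
  calc C * √(k m : ℝ) ≤ C * (ε / C * √(ν m)) := by gcongr
    _ = ε * √(ν m) := by field_simp

end PartialSums

/-! ### The first passage over the boundary, pathwise -/

/-- A realization of the detector: with `s = sign Δ`, `d = |Δ|`, `ρ = √m` and change point `ks`, the
statistic at time `k > ks` is `ks * S / ρ + (k - ks) * (S' / ρ + s * d) + N k`, and the boundary is
`c * (ρ + k / ρ)`. The deterministic approximation of the delay time is `ks + c * ρ / d`. The fields
say that all the error terms are small compared to the tolerance `ε`; `δ` is the relative width of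
the window around the approximate delay time, in which the noise `s * N k` has to be nearly
constant. -/
structure RegularPath (ks : ℕ) (S S' s c ρ d V : ℝ) (N : ℕ → ℝ) (ε C δ A : ℝ) : Prop where
  A_eq : A = ks + c * ρ / d
  rho_pos : 0 < ρ
  c_pos : 0 < c
  d_pos : 0 < d
  s_sq : s * s = 1
  eps_pos : 0 < ε
  eps_le : ε ≤ 1
  C_ge : 1 ≤ C
  delta_pos : 0 < δ
  delta_le : δ ≤ 1 / 2
  abs_S_le : |S| ≤ C
  abs_S'_le : |S'| ≤ C
  eta_le : 16 * C * ((1 + c) / (ρ * d)) ≤ δ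
  delta_le_eps : (C + 3) * δ ≤ ε
  le_delta_mul : 8 * (C + 1) ≤ δ * (d * √A)
  four_le : 4 ≤ δ * A
  d_le : d ≤ ε * √A
  le_boundary : 16 * (C + 1) * √A ≤ c * (ρ + ks / ρ)
  drift_le : C * (ks / ρ) ≤ 1 / 2 * (c * (ρ + ks / ρ))
  noise_le : ∀ k : ℕ, ks < k → (k : ℝ) ≤ 2 * A → |N k| ≤ C * √A
  noise_window : ∀ k : ℕ, ks < k → |(k : ℝ) - A| ≤ δ * A → |s * N k - V * √A| ≤ ε / 4 * √A
  abs_V_le : |V| ≤ C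

/-- The coefficient of the drift of the detector relative to the boundary. -/
def driftFactor (S' s c ρ d : ℝ) : ℝ := 1 - c / (ρ * d) + S' * s / (ρ * d)

/-- The zero of the drift of the detector relative to the boundary. -/
def driftZero (ks : ℕ) (S S' s c ρ d : ℝ) : ℝ :=
  (driftFactor S' s c ρ d)⁻¹ * (ks + ks * ((S' - S) * s / (ρ * d)) + c * ρ / d)

/-- The detector at a time `k > ks`. -/
def detectorPath (ks : ℕ) (S S' s ρ d : ℝ) (N : ℕ → ℝ) (k : ℕ) : ℝ :=
  ks * (S / ρ) + (k - ks) * (S' / ρ + s * d) + N k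

namespace RegularPath

variable {ks : ℕ} {S S' s c ρ d V : ℝ} {N : ℕ → ℝ} {ε C δ A : ℝ}

lemma abs_s (h : RegularPath ks S S' s c ρ d V N ε C δ A) : |s| = 1 := by
  have := h.s_sq
  rw [← abs_mul_abs_self] at this
  nlinarith [abs_nonneg s]

lemma A_pos (h : RegularPath ks S S' s c ρ d V N ε C δ A) : 0 < A := by
  have := h.four_le
  have := h.delta_pos
  by_contra h0
  nlinarith [not_lt.1 h0]

lemma abs_driftFactor_sub_one (h : RegularPath ks S S' s c ρ d V N ε C δ A) :
    |driftFactor S' s c ρ d - 1| ≤ δ / 16 := by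
  have hρd : 0 < ρ * d := mul_pos h.rho_pos h.d_pos
  have h1 : driftFactor S' s c ρ d - 1 = (S' * s - c) / (ρ * d) := by
    unfold driftFactor; ring
  rw [h1, abs_div, abs_of_pos hρd]
  have h2 : |S' * s - c| ≤ C * (1 + c) := by
    refine (abs_sub _ _).trans ?_
    rw [abs_mul, h.abs_s, mul_one, abs_of_pos h.c_pos]
    nlinarith [h.abs_S'_le, h.C_ge, h.c_pos]
  have h3 := h.eta_le
  calc |S' * s - c| / (ρ * d) ≤ C * (1 + c) / (ρ * d) := by gcongr
    _ = (16 * C * ((1 + c) / (ρ * d))) / 16 := by ring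
    _ ≤ δ / 16 := by gcongr

lemma half_le_driftFactor (h : RegularPath ks S S' s c ρ d V N ε C δ A) :
    1 / 2 ≤ driftFactor S' s c ρ d := by
  have := abs_le.1 h.abs_driftFactor_sub_one
  linarith [h.delta_le]

lemma driftFactor_mul_driftZero (h : RegularPath ks S S' s c ρ d V N ε C δ A) :
    driftFactor S' s c ρ d * driftZero ks S S' s c ρ d
      = ks + ks * ((S' - S) * s / (ρ * d)) + c * ρ / d := by
  have := h.half_le_driftFactor
  unfold driftZero
  rw [← mul_assoc, mul_inv_cancel₀ (by linarith), one_mul]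

lemma abs_driftZero_sub (h : RegularPath ks S S' s c ρ d V N ε C δ A) :
    |driftZero ks S S' s c ρ d - A| ≤ δ / 2 * A := by
  have hρd : 0 < ρ * d := mul_pos h.rho_pos h.d_pos
  have hq := h.half_le_driftFactor
  have hq1 := h.abs_driftFactor_sub_one
  have hm := h.driftFactor_mul_driftZero
  set q := driftFactor S' s c ρ d
  set a := driftZero ks S S' s c ρ d
  have hA := h.A_pos
  have hks : (ks : ℝ) ≤ A := by
    rw [h.A_eq]
    have : 0 ≤ c * ρ / d := div_nonneg (mul_nonneg h.c_pos.le h.rho_pos.le) h.d_pos.le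
    linarith
  have h1 : q * (a - A) = ks * ((S' - S) * s / (ρ * d)) + (1 - q) * A := by
    rw [mul_sub, hm, h.A_eq]; ring
  have h2 : |(S' - S) * s / (ρ * d)| ≤ δ / 8 := by
    rw [abs_div, abs_mul, h.abs_s, mul_one, abs_of_pos hρd]
    have h3 : |S' - S| ≤ 2 * C * (1 + c) := by
      refine (abs_sub _ _).trans ?_
      nlinarith [h.abs_S'_le, h.abs_S_le, h.C_ge, h.c_pos]
    have h4 := h.eta_le
    calc |S' - S| / (ρ * d) ≤ 2 * C * (1 + c) / (ρ * d) := by gcongr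
      _ = (16 * C * ((1 + c) / (ρ * d))) / 8 := by ring
      _ ≤ δ / 8 := by gcongr
  have h5 : |q * (a - A)| ≤ δ / 4 * A := by
    rw [h1]
    refine (abs_add_le _ _).trans ?_
    rw [abs_mul, abs_mul, abs_of_pos hA, abs_sub_comm 1 q, Nat.abs_cast]
    have h6 : (ks : ℝ) * |(S' - S) * s / (ρ * d)| ≤ A * (δ / 8) := by gcongr
    have h7 : |q - 1| * A ≤ δ / 16 * A := by gcongr
    have := mul_pos h.delta_pos hA
    linarith
  rw [abs_mul, abs_of_pos (by linarith : 0 < q)] at h5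
  nlinarith [abs_nonneg (a - A)]

/-- The signed detector minus the boundary is a linear function with zero `driftZero` plus noise. -/
lemma mul_detectorPath_sub (h : RegularPath ks S S' s c ρ d V N ε C δ A) (k : ℕ) :
    s * detectorPath ks S S' s ρ d N k - c * (ρ + k / ρ)
      = driftFactor S' s c ρ d * d * (k - driftZero ks S S' s c ρ d) + s * N k := by
  have hd := h.d_pos.ne'
  have hρ := h.rho_pos.ne'
  have h1 : driftFactor S' s c ρ d * d * (k - driftZero ks S S' s c ρ d)
      = d * (driftFactor S' s c ρ d * k)
        - d * (driftFactor S' s c ρ d * driftZero ks S S' s c ρ d) := by ring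
  rw [h1, h.driftFactor_mul_driftZero]
  unfold driftFactor detectorPath
  have hs := h.s_sq
  field_simp
  linear_combination ρ * d * (k - ks) * hs

lemma le_driftZero_sub (h : RegularPath ks S S' s c ρ d V N ε C δ A) :
    4 * (C + 1) * √A ≤ d * (driftZero ks S S' s c ρ d - ks) := by
  have hd := h.d_pos.ne'
  have hρ := h.rho_pos.ne'
  have hq := h.half_le_driftFactor
  have hq1 := abs_le.1 h.abs_driftFactor_sub_one
  have hm := h.driftFactor_mul_driftZero
  have h1 : driftFactor S' s c ρ d * (d * (driftZero ks S S' s c ρ d - ks))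
      = c * (ρ + ks / ρ) - ks / ρ * (S * s) := by
    have : driftFactor S' s c ρ d * (d * (driftZero ks S S' s c ρ d - ks))
      = d * (driftFactor S' s c ρ d * driftZero ks S S' s c ρ d)
        - d * ks * driftFactor S' s c ρ d := by ring
    rw [this, hm]
    unfold driftFactor
    field_simp
    ring
  have h2 : ks / ρ * (S * s) ≤ C * (ks / ρ) := by
    have h3 : S * s ≤ C :=
      (le_abs_self _).trans (by rw [abs_mul, h.abs_s, mul_one]; exact h.abs_S_le)
    have h4 : (0 : ℝ) ≤ ks / ρ := div_nonneg (Nat.cast_nonneg _) h.rho_pos.le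
    nlinarith
  have h5 := h.drift_le
  have h6 := h.le_boundary
  have h7 : 0 ≤ (C + 1) * √A := mul_nonneg (by linarith [h.C_ge]) (Real.sqrt_nonneg _)
  have h8 : 8 * ((C + 1) * √A)
      ≤ driftFactor S' s c ρ d * (d * (driftZero ks S S' s c ρ d - ks)) := by
    linarith
  have h9 : driftFactor S' s c ρ d ≤ 2 := by linarith [h.delta_le]
  have h10 : 0 < d * (driftZero ks S S' s c ρ d - ks) ∨ d * (driftZero ks S S' s c ρ d - ks) ≤ 0 :=
    lt_or_ge _ _
  rcases h10 with h10 | h10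
  · nlinarith
  · nlinarith

lemma abs_one_sub_driftFactor_mul_V (h : RegularPath ks S S' s c ρ d V N ε C δ A) :
    |(1 - driftFactor S' s c ρ d) * V| ≤ ε / 16 := by
  rw [abs_mul, abs_sub_comm]
  calc _ ≤ δ / 16 * C := mul_le_mul h.abs_driftFactor_sub_one h.abs_V_le (abs_nonneg _)
        (by linarith [h.delta_pos])
    _ ≤ ε / 16 := by nlinarith [h.delta_le_eps, h.delta_pos]

/-- The boundary is crossed at most `√A / d * (ε - V) + 1` after the zero of the drift. -/
lemma exists_crossing (h : RegularPath ks S S' s c ρ d V N ε C δ A) :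
    ∃ k : ℕ, ks < k ∧ c * (ρ + k / ρ) < |detectorPath ks S S' s ρ d N k| ∧
      d * (k - driftZero ks S S' s c ρ d) ≤ √A * (2 * ε - V) := by
  set a := driftZero ks S S' s c ρ d with ha
  have hA := h.A_pos
  have hA' : 0 < √A := Real.sqrt_pos.2 hA
  have hV := abs_le.1 h.abs_V_le
  have hd := h.d_pos
  set y := a + √A / d * (ε - V) with hy
  have hdy : d * (y - a) = √A * (ε - V) := by rw [hy]; field_simp; ring
  have h1 := h.le_driftZero_sub
  rw [← ha] at h1
  have hyks : (ks : ℝ) < y := by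
    have : 0 < d * (y - ks) := by nlinarith [h.eps_pos, h.C_ge]
    have := (mul_pos_iff_of_pos_left hd).1 this
    linarith
  have hyk : y ≤ ⌈y⌉₊ := Nat.le_ceil y
  have hky : (⌈y⌉₊ : ℝ) < y + 1 :=
    Nat.ceil_lt_add_one ((Nat.cast_nonneg ks).trans hyks.le)
  have hks : ks < ⌈y⌉₊ := by exact_mod_cast hyks.trans_le hyk
  have hwin : |(⌈y⌉₊ : ℝ) - A| ≤ δ * A := by
    have h2 := h.abs_driftZero_sub
    rw [← ha] at h2
    have h3 : |√A / d * (ε - V)| ≤ δ * A / 8 := by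
      rw [abs_mul, abs_of_pos (by positivity : 0 < √A / d)]
      have h4 : |ε - V| ≤ C + 1 := by
        rw [abs_le]
        constructor <;> linarith [h.eps_pos, h.eps_le]
      calc _ ≤ √A / d * (C + 1) := by gcongr
        _ = √A / d / 8 * (8 * (C + 1)) := by ring
        _ ≤ √A / d / 8 * (δ * (d * √A)) := by have := h.le_delta_mul; gcongr
        _ = δ * (√A * √A) / 8 := by field_simp
        _ = δ * A / 8 := by rw [Real.mul_self_sqrt hA.le]
    have h5 := abs_le.1 h2
    have h6 := abs_le.1 h3
    have h7 := h.four_le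
    rw [abs_le]
    constructor <;> linarith
  refine ⟨⌈y⌉₊, hks, ?_, ?_⟩
  · have hid := h.mul_detectorPath_sub ⌈y⌉₊
    have hN := (abs_le.1 (h.noise_window _ hks hwin)).1
    have hq := h.half_le_driftFactor
    have hVq := (abs_le.1 h.abs_one_sub_driftFactor_mul_V).1
    have h8 : √A * (ε - V) ≤ d * (⌈y⌉₊ - a) := by rw [← hdy]; gcongr
    have h9 : driftFactor S' s c ρ d * (√A * (ε - V)) ≤ driftFactor S' s c ρ d * (d * (⌈y⌉₊ - a)) :=
      mul_le_mul_of_nonneg_left h8 (by linarith)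
    have h10 : 0 < s * detectorPath ks S S' s ρ d N ⌈y⌉₊ - c * (ρ + ⌈y⌉₊ / ρ) := by
      rw [hid, mul_assoc, ← ha]
      have h11 : 0 < √A * ((1 - driftFactor S' s c ρ d) * V
          + driftFactor S' s c ρ d * ε - ε / 4) := by
        refine mul_pos hA' ?_
        nlinarith [h.eps_pos]
      nlinarith
    have h12 : s * detectorPath ks S S' s ρ d N ⌈y⌉₊ ≤ |detectorPath ks S S' s ρ d N ⌈y⌉₊| := by
      refine (le_abs_self _).trans ?_
      rw [abs_mul, h.abs_s, one_mul]
    linarith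
  · have h13 : d * (⌈y⌉₊ - a) ≤ d * (y - a) + d := by nlinarith
    have := h.d_le
    linarith

/-- The boundary is not crossed earlier than `√A / d * (V + ε)` before the zero of the drift. -/
lemma not_crossing (h : RegularPath ks S S' s c ρ d V N ε C δ A) {k : ℕ} (hk : ks < k)
    (hkz : d * (k - driftZero ks S S' s c ρ d) ≤ √A * (-V - ε)) :
    |detectorPath ks S S' s ρ d N k| ≤ c * (ρ + k / ρ) := by
  set a := driftZero ks S S' s c ρ d with ha
  have hA := h.A_pos
  have hA' : 0 < √A := Real.sqrt_pos.2 hA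
  have hV := abs_le.1 h.abs_V_le
  have hd := h.d_pos
  have hq := h.half_le_driftFactor
  have haA := abs_le.1 h.abs_driftZero_sub
  rw [← ha] at haA
  have hsq : √A * √A = A := Real.mul_self_sqrt hA.le
  have hdelta : d * (δ * A) = δ * (d * √A) * √A := by
    linear_combination -(d * δ) * hsq
  have hkA : (k : ℝ) ≤ A + δ * A := by
    have h1 : d * (k - a) ≤ d * (δ * A / 8) := by
      refine hkz.trans ?_
      have h2 : √A * (-V - ε) ≤ √A * (C + 1) := by
        have := h.eps_pos
        gcongr
        linarith
      have h3 := mul_le_mul_of_nonneg_right h.le_delta_mul hA'.le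
      have h4 : d * (δ * A / 8) = δ * (d * √A) * √A / 8 := by rw [← hdelta]; ring
      linarith
    have h5 := le_of_mul_le_mul_left h1 hd
    have := mul_pos h.delta_pos hA
    linarith
  have hN := abs_le.1 (h.noise_le k hk (by nlinarith [h.delta_le]))
  have hsN : |s * N k| ≤ C * √A := by
    rw [abs_mul, h.abs_s, one_mul]; exact abs_le.2 hN
  -- the noise decides inside the window, the negative drift to the left of it
  have hup : s * detectorPath ks S S' s ρ d N k ≤ c * (ρ + k / ρ) := by
    have hid := h.mul_detectorPath_sub k
    rw [← ha] at hid
    have : driftFactor S' s c ρ d * d * (k - a) + s * N k ≤ 0 := by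
      rcases le_or_gt (A - δ * A) k with hfar | hfar
      · have hwin := (abs_le.1 (h.noise_window k hk (abs_le.2 ⟨by linarith, by linarith⟩))).2
        have hVq := (abs_le.1 h.abs_one_sub_driftFactor_mul_V).2
        have h9 := mul_le_mul_of_nonneg_left hkz (by linarith : 0 ≤ driftFactor S' s c ρ d)
        have h11 : √A * ((1 - driftFactor S' s c ρ d) * V - driftFactor S' s c ρ d * ε + ε / 4)
            ≤ 0 := by
          refine mul_nonpos_of_nonneg_of_nonpos hA'.le ?_
          nlinarith [h.eps_pos]
        nlinarith
      · have h1 : k - a ≤ -(δ * A / 2) := by linarith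
        have h2 : d * (k - a) ≤ d * (-(δ * A / 2)) := by gcongr
        have h3 : d * (-(δ * A / 2)) = -(δ * (d * √A) * √A / 2) := by rw [← hdelta]; ring
        have h4 := mul_le_mul_of_nonneg_right h.le_delta_mul hA'.le
        have h5 : d * (k - a) ≤ -(4 * (C + 1) * √A) := by linarith
        have h6 : 0 ≤ (C + 1) * √A := mul_nonneg (by linarith [h.C_ge]) hA'.le
        have h7 := (abs_le.1 hsN).2
        nlinarith
    linarith
  -- a crossing with the wrong sign is excluded because the boundary at `ks` dominates the noise
  have hlow : -(s * detectorPath ks S S' s ρ d N k) ≤ c * (ρ + k / ρ) := by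
    have h1 : s * detectorPath ks S S' s ρ d N k
        = ks / ρ * (S * s) + (k - ks) * (S' * s / ρ + d) + s * N k := by
      unfold detectorPath
      have hs := h.s_sq
      have hρ := h.rho_pos.ne'
      field_simp
      linear_combination ρ * d * (k - ks) * hs
    have hks0 : (0 : ℝ) ≤ ks / ρ := div_nonneg (Nat.cast_nonneg _) h.rho_pos.le
    have h2 : -(ks / ρ * (S * s)) ≤ C * (ks / ρ) := by
      have h3 : -(S * s) ≤ C :=
        (neg_le_abs _).trans (by rw [abs_mul, h.abs_s, mul_one]; exact h.abs_S_le)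
      nlinarith
    have h4 : 0 ≤ S' * s / ρ + d := by
      have h5 : -(S' * s) ≤ C :=
        (neg_le_abs _).trans (by rw [abs_mul, h.abs_s, mul_one]; exact h.abs_S'_le)
      have hρd : 0 < ρ * d := mul_pos h.rho_pos h.d_pos
      have h6 : C ≤ ρ * d := by
        have h7 := h.eta_le
        rw [mul_div_assoc', div_le_iff₀ hρd] at h7
        have h8 := h.delta_le
        have h9 := h.c_pos
        have h10 := h.C_ge
        nlinarith [mul_pos (by linarith : 0 < C) h9]
      rw [div_add' _ _ _ h.rho_pos.ne']
      exact div_nonneg (by linarith) h.rho_pos.le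
    have hkks : (ks : ℝ) ≤ k := by exact_mod_cast hk.le
    have h5 : 0 ≤ (k - ks) * (S' * s / ρ + d) := mul_nonneg (by linarith) h4
    have h6 := (abs_le.1 hsN).1
    have h7 := h.drift_le
    have h8 := h.le_boundary
    have h9 : c * (ρ + ks / ρ) ≤ c * (ρ + k / ρ) := by
      have := h.rho_pos
      have := h.c_pos
      gcongr
    have h10 : 0 ≤ C * √A := mul_nonneg (by linarith [h.C_ge]) hA'.le
    linarith
  have : |detectorPath ks S S' s ρ d N k| = |s * detectorPath ks S S' s ρ d N k| := by
    rw [abs_mul, h.abs_s, one_mul]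
  rw [this, abs_le]
  exact ⟨by linarith, hup⟩

/-- On a regular path the delay time, centered at the zero `a` of the drift and scaled by `√a / d`,
is the negative of the noise near the approximate delay time, up to a small error. -/
theorem exists_first_crossing (h : RegularPath ks S S' s c ρ d V N ε C δ A) :
    ∃ κ : ℕ, (ks < κ ∧ c * (ρ + κ / ρ) < |detectorPath ks S S' s ρ d N κ|) ∧
      (∀ k, ks < k → c * (ρ + k / ρ) < |detectorPath ks S S' s ρ d N k| → κ ≤ k) ∧
      |((κ : ℝ) - driftZero ks S S' s c ρ d) / (√(driftZero ks S S' s c ρ d) / d) + V|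
        ≤ 3 * ε := by
  classical
  obtain ⟨k₁, hk₁, hcr, hle⟩ := h.exists_crossing
  have hex : ∃ k, ks < k ∧ c * (ρ + k / ρ) < |detectorPath ks S S' s ρ d N k| := ⟨k₁, hk₁, hcr⟩
  have hspec := Nat.find_spec hex
  have hmin : Nat.find hex ≤ k₁ := Nat.find_min' hex ⟨hk₁, hcr⟩
  set κ := Nat.find hex with hκ
  refine ⟨κ, hspec, fun k hk hc => Nat.find_min' hex ⟨hk, hc⟩, ?_⟩
  set a := driftZero ks S S' s c ρ d with ha
  have hd := h.d_pos
  have hA := h.A_pos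
  have hA' : 0 < √A := Real.sqrt_pos.2 hA
  have hup : d * (κ - a) ≤ √A * (2 * ε - V) := by
    refine le_trans ?_ hle
    have : (κ : ℝ) ≤ k₁ := by exact_mod_cast hmin
    gcongr
  have hlow : √A * (-V - ε) ≤ d * (κ - a) := by
    by_contra hcon
    have := h.not_crossing hspec.1 (not_le.1 hcon).le
    exact absurd hspec.2 (not_lt.2 this)
  set v := d * (κ - a) / √A with hv
  have hv1 : v + V ≤ 2 * ε := by
    have : v ≤ 2 * ε - V := by rw [hv, div_le_iff₀ hA']; linarith
    linarith
  have hv2 : -ε ≤ v + V := by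
    have : -V - ε ≤ v := by rw [hv, le_div_iff₀ hA']; linarith
    linarith
  have haA := abs_le.1 h.abs_driftZero_sub
  rw [← ha] at haA
  have hδA := mul_pos h.delta_pos hA
  have hδA2 : δ * A ≤ 1 / 2 * A := mul_le_mul_of_nonneg_right h.delta_le hA.le
  have ha0 : 0 < a := by linarith
  -- passage from the scale `√A / d` to the scale `√a / d`
  have hratio : |√(A / a) - 1| ≤ δ := by
    have h1 : |A / a - 1| ≤ δ := by
      rw [div_sub_one ha0.ne', abs_div, abs_of_pos ha0, div_le_iff₀ ha0, abs_le]
      constructor <;> nlinarith [h.delta_pos]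
    refine le_trans ?_ h1
    have h2 : A / a - 1 = (√(A / a) - 1) * (√(A / a) + 1) := by
      have := Real.mul_self_sqrt (div_pos hA ha0).le
      linear_combination -this
    rw [h2, abs_mul]
    have h3 : 1 ≤ |√(A / a) + 1| := by
      rw [abs_of_nonneg (by positivity)]
      linarith [Real.sqrt_nonneg (A / a)]
    nlinarith [abs_nonneg (√(A / a) - 1)]
  have heq : ((κ : ℝ) - a) / (√a / d) = v * √(A / a) := by
    have : √a ≠ 0 := (Real.sqrt_pos.2 ha0).ne'
    rw [Real.sqrt_div' _ ha0.le, hv]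
    field_simp
  have hvabs : |v| ≤ C + 2 := by
    have := abs_le.1 h.abs_V_le
    rw [abs_le]
    constructor <;> linarith [h.eps_le]
  have hfin : |v * (√(A / a) - 1)| ≤ ε := by
    rw [abs_mul]
    calc _ ≤ (C + 2) * δ := mul_le_mul hvabs hratio (abs_nonneg _) (by linarith [h.C_ge])
      _ ≤ ε := by nlinarith [h.delta_le_eps, h.delta_pos]
  have hfin' := abs_le.1 hfin
  rw [heq, abs_le]
  have h5 : v * √(A / a) + V = v * (√(A / a) - 1) + (v + V) := by ring
  rw [h5]
  constructor <;> linarith [h.eps_pos]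

end RegularPath

namespace MonitoringModel

/-! ### Orders of magnitude in the change point model -/

variable {Ω : Type*} [MeasurableSpace Ω] (M : MonitoringModel Ω) (P : Measure Ω)

/-- The deterministic first order approximation `k* + c √m / |Δ|` of the delay time. -/
def approxDelay (m : ℕ) : ℝ := M.kstar m + M.c m * √(m : ℝ) / |M.Delta P m|

/-- The relative error of the approximation of `a_m` by `approxDelay`, up to a constant. -/
def relError (m : ℕ) : ℝ := (1 + M.c m) / (√(m : ℝ) * |M.Delta P m|)

/-- The relative width of a window around `approxDelay` that contains the delay time with high
probability. It tends to zero more slowly than the relative errors of the approximations and than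
the inverse of the signal to noise ratio `|Δ| * √approxDelay`. -/
def windowWidth (m : ℕ) : ℝ :=
  √(M.relError P m) + (√(|M.Delta P m| * √(M.approxDelay P m)))⁻¹

variable {M P}

lemma tendsto_sqrt_natCast : Tendsto (fun m : ℕ => √(m : ℝ)) atTop atTop :=
  Real.tendsto_sqrt_atTop.comp tendsto_natCast_atTop_atTop

lemma ChangeMagnitude.exists_abs_Delta_le (h : M.ChangeMagnitude P) :
    ∃ B : ℝ, 0 < B ∧ ∀ᶠ m in atTop, |M.Delta P m| ≤ B := by
  obtain ⟨B, hB0, hB⟩ := h.bounded.exists_pos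
  exact ⟨B, hB0, by simpa using hB.bound⟩

lemma ThresholdAssumptions.c_pos (h : M.ThresholdAssumptions P) : ∀ᶠ m in atTop, 0 < M.c m := by
  obtain ⟨c₀, h0, h1⟩ := h.liminf_pos
  filter_upwards [h1] with m hm using h0.trans_le hm

lemma ChangeMagnitude.abs_Delta_pos (h : M.ChangeMagnitude P) :
    ∀ᶠ m in atTop, 0 < |M.Delta P m| := by
  filter_upwards [h.detectable.eventually_gt_atTop 0] with m hm
  refine (abs_nonneg _).lt_of_ne fun h0 => ?_
  rw [← h0] at hm
  simp at hm

section

variable (hc : M.ChangeMagnitude P) (ht : M.ThresholdAssumptions P)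

include hc in
lemma tendsto_c_div : Tendsto (fun m : ℕ => M.c m / (√(m : ℝ) * |M.Delta P m|)) atTop (𝓝 0) := by
  refine (tendsto_inv_atTop_zero.comp hc.detectable).congr fun m => ?_
  simp

include hc ht in
lemma tendsto_sqrt_mul_Delta : Tendsto (fun m : ℕ => √(m : ℝ) * |M.Delta P m|) atTop atTop := by
  obtain ⟨c₀, h0, h1⟩ := ht.liminf_pos
  refine tendsto_atTop_mono' _ ?_ (hc.detectable.const_mul_atTop h0)
  filter_upwards [h1] with m hm
  have hcm : 0 < M.c m := h0.trans_le hm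
  calc c₀ * (√(m : ℝ) * |M.Delta P m| / M.c m) ≤ M.c m * (√(m : ℝ) * |M.Delta P m| / M.c m) := by
        gcongr
    _ = _ := by field_simp

include hc ht in
lemma tendsto_relError : Tendsto (M.relError P) atTop (𝓝 0) := by
  have := (tendsto_inv_atTop_zero.comp (tendsto_sqrt_mul_Delta hc ht)).add (tendsto_c_div hc)
  rw [add_zero] at this
  refine this.congr fun m => ?_
  simp only [relError, Function.comp]
  ring

include hc ht in
lemma relError_pos : ∀ᶠ m in atTop, 0 < M.relError P m := by
  filter_upwards [(tendsto_sqrt_mul_Delta hc ht).eventually_gt_atTop 0, ht.c_pos] with m h1 h2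
  unfold relError
  positivity

include hc ht in
lemma tendsto_approxDelay_sub :
    Tendsto (fun m : ℕ => M.c m * √(m : ℝ) / |M.Delta P m|) atTop atTop := by
  obtain ⟨c₀, h0, h1⟩ := ht.liminf_pos
  obtain ⟨B, hB0, hB⟩ := hc.exists_abs_Delta_le
  refine tendsto_atTop_mono' _ ?_ (tendsto_sqrt_natCast.const_mul_atTop (div_pos h0 hB0))
  filter_upwards [h1, hB, hc.abs_Delta_pos] with m h1 h2 h3
  calc c₀ / B * √(m : ℝ) = c₀ * √(m : ℝ) / B := by ring
    _ ≤ _ := by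
      have := h0.trans_le h1
      gcongr

include hc ht in
lemma tendsto_approxDelay : Tendsto (M.approxDelay P) atTop atTop :=
  tendsto_atTop_mono (fun m => by unfold approxDelay; linarith [(M.kstar m).cast_nonneg (α := ℝ)])
    (tendsto_approxDelay_sub hc ht)

include hc ht in
lemma tendsto_signalToNoise :
    Tendsto (fun m => |M.Delta P m| * √(M.approxDelay P m)) atTop atTop := by
  obtain ⟨c₀, h0, h1⟩ := ht.liminf_pos
  refine tendsto_atTop_mono' _ ?_ (Real.tendsto_sqrt_atTop.comp
    ((tendsto_sqrt_mul_Delta hc ht).const_mul_atTop h0))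
  filter_upwards [h1, hc.abs_Delta_pos] with m h1 h3
  have h4 : |M.Delta P m| * √(M.approxDelay P m)
      = √(|M.Delta P m| ^ 2 * M.approxDelay P m) := by
    rw [Real.sqrt_mul (by positivity), Real.sqrt_sq h3.le]
  rw [h4]
  refine Real.sqrt_le_sqrt ?_
  have h5 : (0 : ℝ) ≤ M.kstar m := Nat.cast_nonneg _
  have h6 : |M.Delta P m| ^ 2 * M.approxDelay P m
      = |M.Delta P m| ^ 2 * M.kstar m + M.c m * (√(m : ℝ) * |M.Delta P m|) := by
    unfold approxDelay
    field_simp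
  rw [h6]
  have : c₀ * (√(m : ℝ) * |M.Delta P m|) ≤ M.c m * (√(m : ℝ) * |M.Delta P m|) := by gcongr
  nlinarith [mul_nonneg (sq_nonneg |M.Delta P m|) h5]

include hc ht in
lemma tendsto_windowWidth : Tendsto (M.windowWidth P) atTop (𝓝 0) := by
  have h1 := (Real.continuous_sqrt.tendsto 0).comp (tendsto_relError hc ht)
  rw [Real.sqrt_zero] at h1
  have h2 := tendsto_inv_atTop_zero.comp
    (Real.tendsto_sqrt_atTop.comp (tendsto_signalToNoise hc ht))
  have h3 := h1.add h2
  rw [add_zero] at h3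
  exact h3

include hc ht in
lemma windowWidth_pos : ∀ᶠ m in atTop, 0 < M.windowWidth P m := by
  filter_upwards [(tendsto_signalToNoise hc ht).eventually_gt_atTop 0] with m hm
  unfold windowWidth
  have := Real.sqrt_nonneg (M.relError P m)
  positivity

include hc ht in
lemma mul_relError_le_windowWidth (K : ℝ) :
    ∀ᶠ m in atTop, K * M.relError P m ≤ M.windowWidth P m := by
  have h1 := ((tendsto_relError hc ht).sqrt.const_mul K)
  rw [Real.sqrt_zero, mul_zero] at h1
  filter_upwards [h1.eventually (ge_mem_nhds zero_lt_one), relError_pos hc ht,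
    (tendsto_signalToNoise hc ht).eventually_gt_atTop 0] with m h2 h3 h4
  have h5 : K * M.relError P m ≤ √(M.relError P m) := by
    calc K * M.relError P m = (K * √(M.relError P m)) * √(M.relError P m) := by
          rw [mul_assoc, Real.mul_self_sqrt h3.le]
      _ ≤ 1 * √(M.relError P m) := by gcongr
      _ = _ := one_mul _
  refine h5.trans ?_
  unfold windowWidth
  have := Real.sqrt_nonneg (|M.Delta P m| * √(M.approxDelay P m))
  linarith [inv_nonneg.2 this]

include hc ht in
lemma tendsto_windowWidth_mul_signalToNoise :
    Tendsto (fun m => M.windowWidth P m * (|M.Delta P m| * √(M.approxDelay P m))) atTop atTop := by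
  refine tendsto_atTop_mono' _ ?_ (Real.tendsto_sqrt_atTop.comp (tendsto_signalToNoise hc ht))
  filter_upwards [(tendsto_signalToNoise hc ht).eventually_gt_atTop 0] with m hm
  have h1 : √(|M.Delta P m| * √(M.approxDelay P m))
      = (√(|M.Delta P m| * √(M.approxDelay P m)))⁻¹ * (|M.Delta P m| * √(M.approxDelay P m)) := by
    rw [inv_mul_eq_div, Real.div_sqrt]
  simp only [Function.comp]
  rw [windowWidth, add_mul, ← h1]
  have := mul_nonneg (Real.sqrt_nonneg (M.relError P m)) hm.le
  linarith

include hc ht in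
lemma Delta_le_mul_sqrt_approxDelay {ε : ℝ} (hε : 0 < ε) :
    ∀ᶠ m in atTop, |M.Delta P m| ≤ ε * √(M.approxDelay P m) := by
  obtain ⟨B, hB0, hB⟩ := hc.exists_abs_Delta_le
  filter_upwards [hB, ((Real.tendsto_sqrt_atTop.comp
    (tendsto_approxDelay hc ht)).const_mul_atTop hε).eventually_ge_atTop B] with m h1 h2
  exact h1.trans h2

include hc ht in
lemma tendsto_windowWidth_mul_approxDelay :
    Tendsto (fun m => M.windowWidth P m * M.approxDelay P m) atTop atTop := by
  refine tendsto_atTop_mono' _ ?_ (tendsto_windowWidth_mul_signalToNoise hc ht)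
  filter_upwards [Delta_le_mul_sqrt_approxDelay hc ht one_pos, windowWidth_pos hc ht,
    (tendsto_approxDelay hc ht).eventually_ge_atTop 0] with m h1 h2 h3
  refine mul_le_mul_of_nonneg_left ?_ h2.le
  calc _ ≤ 1 * √(M.approxDelay P m) * √(M.approxDelay P m) := by gcongr
    _ = _ := by rw [one_mul, Real.mul_self_sqrt h3]

lemma kstar_le (m : ℕ) : (M.kstar m : ℝ) ≤ M.lam * (m : ℝ) ^ M.beta :=
  Nat.floor_le (mul_nonneg M.lam_pos.le (Real.rpow_nonneg (Nat.cast_nonneg _) _))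

include ht in
lemma mul_kstar_div_le (C : ℝ) : ∀ᶠ m : ℕ in atTop,
    C * (M.kstar m / √(m : ℝ)) ≤ M.c m * (√(m : ℝ) + M.kstar m / √(m : ℝ)) := by
  have hl := M.lam_pos
  have hκ : 0 < min 1 M.lam⁻¹ := lt_min one_pos (inv_pos.2 hl)
  filter_upwards [(ht.diverges.const_mul_atTop hκ).eventually_ge_atTop C, ht.c_pos,
    eventually_gt_atTop 0] with m h1 h2 h3
  have hm : (0 : ℝ) < m := by exact_mod_cast h3
  have hρ : 0 < √(m : ℝ) := Real.sqrt_pos.2 hm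
  have h4 : 0 ≤ (M.kstar m : ℝ) / √(m : ℝ) := by positivity
  refine (mul_le_mul_of_nonneg_right h1 h4).trans ?_
  have h5 : min 1 M.lam⁻¹ * (m : ℝ) ^ (1 - M.beta) * (M.kstar m / √(m : ℝ)) ≤ √(m : ℝ) := by
    calc _ ≤ M.lam⁻¹ * (m : ℝ) ^ (1 - M.beta) * (M.lam * (m : ℝ) ^ M.beta / √(m : ℝ)) := by
          have := kstar_le (M := M) m
          gcongr
          exact min_le_right _ _
      _ = ((m : ℝ) ^ (1 - M.beta) * (m : ℝ) ^ M.beta) / √(m : ℝ) := by field_simp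
      _ = √(m : ℝ) := by
          rw [← Real.rpow_add hm]
          simp
  have h6 : min 1 M.lam⁻¹ * (M.kstar m / √(m : ℝ)) ≤ M.kstar m / √(m : ℝ) := by
    calc _ ≤ 1 * ((M.kstar m : ℝ) / √(m : ℝ)) := by
          gcongr
          exact min_le_left _ _
      _ = _ := one_mul _
  rcases max_cases 1 ((m : ℝ) ^ (1 - M.beta)) with ⟨h7, -⟩ | ⟨h7, -⟩
  · rw [h7]
    nlinarith
  · rw [h7]
    nlinarith

include hc ht in
/-- At the change point the boundary dominates the noise. -/
lemma mul_sqrt_approxDelay_le {K : ℝ} (hK : 0 < K) : ∀ᶠ m : ℕ in atTop,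
    K * √(M.approxDelay P m) ≤ M.c m * (√(m : ℝ) + M.kstar m / √(m : ℝ)) := by
  obtain ⟨c₀, h0, h1⟩ := ht.liminf_pos
  filter_upwards [mul_kstar_div_le ht (2 * K ^ 2 / c₀), h1,
    (tendsto_sqrt_mul_Delta hc ht).eventually_ge_atTop (2 * K ^ 2 / c₀), hc.abs_Delta_pos,
    eventually_gt_atTop 0, (tendsto_approxDelay hc ht).eventually_ge_atTop 0]
    with m h2 h3 h4 h5 h6 h7
  have hm : (0 : ℝ) < m := by exact_mod_cast h6
  have hρ : 0 < √(m : ℝ) := Real.sqrt_pos.2 hm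
  have hcm : 0 < M.c m := h0.trans_le h3
  set G := M.c m * (√(m : ℝ) + M.kstar m / √(m : ℝ)) with hG
  have hG1 : M.c m * √(m : ℝ) ≤ G := by
    rw [hG, mul_add]
    have : 0 ≤ M.c m * ((M.kstar m : ℝ) / √(m : ℝ)) := by positivity
    linarith
  have hG2 : c₀ * √(m : ℝ) ≤ G := (mul_le_mul_of_nonneg_right h3 hρ.le).trans hG1
  have hG0 : 0 < G := (by positivity : 0 < c₀ * √(m : ℝ)).trans_le hG2
  have e1 : 2 * K ^ 2 * M.kstar m ≤ G * G := by
    calc 2 * K ^ 2 * M.kstar m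
        = (c₀ * √(m : ℝ)) * (2 * K ^ 2 / c₀ * (M.kstar m / √(m : ℝ))) := by field_simp
      _ ≤ G * G := mul_le_mul hG2 h2 (by positivity) hG0.le
  have e2 : 2 * K ^ 2 * (M.c m * √(m : ℝ) / |M.Delta P m|) ≤ G * G := by
    calc 2 * K ^ 2 * (M.c m * √(m : ℝ) / |M.Delta P m|)
        = 2 * K ^ 2 / c₀ * (c₀ * M.c m * √(m : ℝ) / |M.Delta P m|) := by field_simp
      _ ≤ (√(m : ℝ) * |M.Delta P m|) * (M.c m * M.c m * √(m : ℝ) / |M.Delta P m|) := by gcongr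
      _ = (M.c m * √(m : ℝ)) * (M.c m * √(m : ℝ)) := by field_simp
      _ ≤ G * G := by gcongr
  have e3 : K ^ 2 * M.approxDelay P m ≤ G ^ 2 := by
    unfold approxDelay
    nlinarith
  have e4 := Real.sqrt_le_sqrt e3
  rwa [Real.sqrt_mul (by positivity), Real.sqrt_sq hK.le, Real.sqrt_sq hG0.le] at e4

include hc in
/-- The approximate delay time grows at most polynomially. -/
lemma exists_approxDelay_le_pow :
    ∃ p : ℕ, ∀ᶠ m : ℕ in atTop, 4 * M.approxDelay P m + 4 ≤ (m : ℝ) ^ p := by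
  refine ⟨⌈M.beta⌉₊ + 2, ?_⟩
  have h1 : ∀ᶠ m : ℕ in atTop, 4 * M.lam + 8 ≤ (m : ℝ) :=
    tendsto_natCast_atTop_atTop.eventually_ge_atTop _
  filter_upwards [h1, eventually_ge_atTop 1,
    (tendsto_c_div hc).eventually (ge_mem_nhds zero_lt_one), hc.abs_Delta_pos] with m h1 h2 h3 h4
  have hm : (1 : ℝ) ≤ m := by exact_mod_cast h2
  have hρ : 0 < √(m : ℝ) := Real.sqrt_pos.2 (by linarith)
  have e1 : M.c m * √(m : ℝ) / |M.Delta P m| ≤ m := by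
    calc M.c m * √(m : ℝ) / |M.Delta P m|
        = M.c m / (√(m : ℝ) * |M.Delta P m|) * (√(m : ℝ) * √(m : ℝ)) := by field_simp
      _ ≤ 1 * (√(m : ℝ) * √(m : ℝ)) := by gcongr
      _ = m := by rw [one_mul, Real.mul_self_sqrt (by linarith)]
  have e2 : (M.kstar m : ℝ) ≤ M.lam * (m : ℝ) ^ (⌈M.beta⌉₊ + 1) := by
    refine (kstar_le m).trans ?_
    have hl := M.lam_pos
    gcongr
    rw [← Real.rpow_natCast]
    refine Real.rpow_le_rpow_of_exponent_le hm ?_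
    push_cast
    linarith [Nat.le_ceil M.beta]
  have e3 : (m : ℝ) ≤ (m : ℝ) ^ (⌈M.beta⌉₊ + 1) := le_self_pow₀ hm (by omega)
  have e4 : (1 : ℝ) ≤ (m : ℝ) ^ (⌈M.beta⌉₊ + 1) := one_le_pow₀ hm
  have e5 : (m : ℝ) ^ (⌈M.beta⌉₊ + 2) = m * (m : ℝ) ^ (⌈M.beta⌉₊ + 1) := by ring
  rw [e5, approxDelay]
  nlinarith

/-- The limit of the proportion of the monitoring time before the change. -/
def limitProportion (M : MonitoringModel Ω) (D : ℝ≥0∞) : ℝ :=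
  if D = ⊤ then 1 else M.lam * D.toReal / (1 + M.lam * D.toReal)

include hc ht in
lemma tendsto_kstar_div_approxDelay {D : ℝ≥0∞}
    (hD : Tendsto (fun m : ℕ =>
        ENNReal.ofReal ((m : ℝ) ^ (M.beta - 1) * (√(m : ℝ) * |M.Delta P m| / M.c m)))
      atTop (𝓝 D)) :
    Tendsto (fun m => (M.kstar m : ℝ) / M.approxDelay P m) atTop (𝓝 (M.limitProportion D)) := by
  set x : ℕ → ℝ := fun m => (m : ℝ) ^ (M.beta - 1) * (√(m : ℝ) * |M.Delta P m| / M.c m) with hx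
  set y : ℕ → ℝ := fun m => M.kstar m * |M.Delta P m| / (M.c m * √(m : ℝ)) with hy
  have hl := M.lam_pos
  have hsmall : Tendsto (fun m : ℕ => |M.Delta P m| / (M.c m * √(m : ℝ))) atTop (𝓝 0) := by
    refine (tendsto_inv_atTop_zero.comp (tendsto_approxDelay_sub hc ht)).congr fun m => ?_
    simp
  have hmain : ∀ᶠ m : ℕ in atTop, M.lam * x m
      = M.lam * (m : ℝ) ^ M.beta * (|M.Delta P m| / (M.c m * √(m : ℝ))) := by
    filter_upwards [ht.c_pos, eventually_gt_atTop 0] with m h1 h2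
    have hm : (0 : ℝ) < m := by exact_mod_cast h2
    have hρ : 0 < √(m : ℝ) := Real.sqrt_pos.2 hm
    have : (m : ℝ) ^ M.beta = (m : ℝ) ^ (M.beta - 1) * (√(m : ℝ) * √(m : ℝ)) := by
      rw [Real.mul_self_sqrt hm.le, ← Real.rpow_add_one hm.ne']
      simp
    rw [this, hx]
    field_simp
  have hyx : ∀ᶠ m : ℕ in atTop, y m ≤ M.lam * x m := by
    filter_upwards [hmain, ht.c_pos] with m h1 h2
    rw [h1, hy]
    simp only
    rw [mul_div_assoc]
    have := kstar_le (M := M) m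
    gcongr
  have hxy : ∀ᶠ m : ℕ in atTop, M.lam * x m - |M.Delta P m| / (M.c m * √(m : ℝ)) ≤ y m := by
    filter_upwards [hmain, ht.c_pos] with m h1 h2
    rw [h1, hy]
    simp only
    rw [mul_div_assoc]
    have h3 : M.lam * (m : ℝ) ^ M.beta - 1 ≤ M.kstar m := (Nat.sub_one_lt_floor _).le
    have h4 : 0 ≤ |M.Delta P m| / (M.c m * √(m : ℝ)) := by positivity
    nlinarith
  have hratio : ∀ᶠ m in atTop, (M.kstar m : ℝ) / M.approxDelay P m = 1 - (1 + y m)⁻¹ := by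
    filter_upwards [ht.c_pos, hc.abs_Delta_pos, eventually_gt_atTop 0] with m h1 h2 h3
    have hm : (0 : ℝ) < m := by exact_mod_cast h3
    have hρ : 0 < √(m : ℝ) := Real.sqrt_pos.2 hm
    rw [hy, approxDelay]
    have : 0 < (M.kstar m : ℝ) + M.c m * √(m : ℝ) / |M.Delta P m| := by positivity
    have h5 : 0 < M.c m * √(m : ℝ) + M.kstar m * |M.Delta P m| := by positivity
    have h6 : 0 < (M.kstar m : ℝ) * |M.Delta P m| + M.c m * √(m : ℝ) := by positivity
    field_simp
    ring
  refine Tendsto.congr' (hratio.mono fun _ h => h.symm) ?_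
  unfold limitProportion
  split_ifs with hDt
  · rw [hDt] at hD
    have hxt : Tendsto x atTop atTop := ENNReal.tendsto_ofReal_nhds_top.1 hD
    have hyt : Tendsto y atTop atTop := by
      refine tendsto_atTop_mono' _ hxy ?_
      exact (hxt.const_mul_atTop hl).atTop_add hsmall.neg
    have := tendsto_inv_atTop_zero.comp (tendsto_atTop_add_const_left _ 1 hyt)
    simpa using this.const_sub 1
  · have hxt : Tendsto x atTop (𝓝 D.toReal) := by
      refine ((ENNReal.tendsto_toReal hDt).comp hD).congr' ?_
      filter_upwards [ht.c_pos] with m h1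
      exact ENNReal.toReal_ofReal (by positivity)
    have h1 : Tendsto y atTop (𝓝 (M.lam * D.toReal)) := by
      refine tendsto_of_tendsto_of_tendsto_of_le_of_le' ?_ (hxt.const_mul M.lam) hxy hyx
      simpa using (hxt.const_mul M.lam).sub hsmall
    have h0 : 0 < 1 + M.lam * D.toReal := by
      have := mul_nonneg hl.le (ENNReal.toReal_nonneg (a := D))
      linarith
    have h2 := ((h1.const_add 1).inv₀ h0.ne').const_sub 1
    convert h2 using 2
    field_simp
    ring

end

lemma limitProportion_mem (M : MonitoringModel Ω) (D : ℝ≥0∞) :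
    M.limitProportion D ∈ Set.Icc (0 : ℝ) 1 := by
  unfold limitProportion
  have h1 := mul_nonneg M.lam_pos.le (ENNReal.toReal_nonneg (a := D))
  split_ifs
  · simp
  · exact ⟨by positivity, (div_le_one (by positivity)).2 (by linarith)⟩

lemma limitVariance_eq (M : MonitoringModel Ω) (σ τ : ℝ) (D : ℝ≥0∞) :
    M.limitVariance σ τ D
      = M.limitProportion D * σ ^ 2 + (1 - M.limitProportion D) * τ ^ 2 := by
  have h1 := mul_nonneg M.lam_pos.le (ENNReal.toReal_nonneg (a := D))
  unfold limitVariance limitProportion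
  by_cases h0 : D = 0
  · simp [h0]
  by_cases ht : D = ⊤
  · simp [ht]
  simp only [h0, ht, if_false]
  have : 1 + M.lam * D.toReal ≠ 0 := by positivity
  field_simp
  ring

end MonitoringModel

/-! ### Convergence in distribution -/

section ConvergenceInDistribution

variable {Ω : Type*} [MeasurableSpace Ω] {P : Measure Ω} [IsProbabilityMeasure P]

lemma tendstoInMeasure_zero_of_measureReal {X : ℕ → Ω → ℝ}
    (h : ∀ ε : ℝ, 0 < ε → Tendsto (fun m => P.real {ω | ε < |X m ω|}) atTop (𝓝 0)) :
    TendstoInMeasure P X atTop 0 := by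
  rw [tendstoInMeasure_iff_measureReal_norm]
  intro ε hε
  refine squeeze_zero (fun _ => measureReal_nonneg) (fun m => measureReal_mono ?_)
    (h (ε / 2) (half_pos hε))
  intro ω hω
  simp only [Set.mem_ofPred_eq, Pi.zero_apply, sub_zero, Real.norm_eq_abs] at hω ⊢
  linarith

lemma tendstoInDistribution_iff_integral {E : Type*} [TopologicalSpace E] [MeasurableSpace E]
    [OpensMeasurableSpace E] {Ω' : Type*} [MeasurableSpace Ω'] {P' : Measure Ω'}
    [IsProbabilityMeasure P'] {X : ℕ → Ω → E} {Z : Ω' → E} (hX : ∀ m, AEMeasurable (X m) P)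
    (hZ : AEMeasurable Z P') :
    TendstoInDistribution X atTop Z (fun _ => P) P' ↔
      ∀ F : E →ᵇ ℝ, Tendsto (fun m => ∫ ω, F (X m ω) ∂P) atTop (𝓝 (∫ ω, F (Z ω) ∂P')) := by
  have h1 : ∀ (F : E →ᵇ ℝ) (m : ℕ), ∫ x, F x ∂(P.map (X m)) = ∫ ω, F (X m ω) ∂P := fun F m =>
    integral_map (hX m) F.continuous.measurable.aestronglyMeasurable
  have h2 : ∀ F : E →ᵇ ℝ, ∫ x, F x ∂(P'.map Z) = ∫ ω, F (Z ω) ∂P' := fun F =>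
    integral_map hZ F.continuous.measurable.aestronglyMeasurable
  constructor
  · intro h F
    have h3 := ProbabilityMeasure.tendsto_iff_forall_integral_tendsto.1 h.tendsto F
    simp only [ProbabilityMeasure.coe_mk] at h3
    rw [h2] at h3
    exact h3.congr fun m => h1 F m
  · intro h
    refine ⟨hX, hZ, ProbabilityMeasure.tendsto_iff_forall_integral_tendsto.2 fun F => ?_⟩
    simp only [ProbabilityMeasure.coe_mk]
    rw [h2]
    exact (h F).congr fun m => (h1 F m).symm

/-- Convergence in distribution only depends on the laws of the random variables. -/
lemma TendstoInDistribution.congr_identDistrib {X Y : ℕ → Ω → ℝ} {μ : Measure ℝ}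
    [IsProbabilityMeasure μ] (h : TendstoInDistribution X atTop (id : ℝ → ℝ) (fun _ => P) μ)
    (hXY : ∀ m, IdentDistrib (X m) (Y m) P P) :
    TendstoInDistribution Y atTop (id : ℝ → ℝ) (fun _ => P) μ := by
  rw [tendstoInDistribution_iff_integral (fun m => (hXY m).aemeasurable_snd) aemeasurable_id]
  rw [tendstoInDistribution_iff_integral (fun m => (hXY m).aemeasurable_fst) aemeasurable_id] at h
  refine fun F => (h F).congr fun m => ?_
  exact ((hXY m).comp F.continuous.measurable).integral_eq

lemma TendstoInDistribution.const_seq_mul {X : ℕ → Ω → ℝ} {μ : Measure ℝ}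
    [IsProbabilityMeasure μ] (h : TendstoInDistribution X atTop (id : ℝ → ℝ) (fun _ => P) μ)
    {a : ℕ → ℝ} (ha : Tendsto a atTop (𝓝 1)) :
    TendstoInDistribution (fun m ω => a m * X m ω) atTop (id : ℝ → ℝ) (fun _ => P) μ := by
  have h1 : TendstoInMeasure P (fun m (_ : Ω) => a m) atTop fun _ => (1 : ℝ) :=
    tendstoInMeasure_of_tendsto_ae (fun _ => aestronglyMeasurable_const)
      (Eventually.of_forall fun _ => ha)
  have h2 := h.continuous_comp_prodMk_of_tendstoInMeasure_const
    (g := fun x : ℝ × ℝ => x.2 * x.1) (by fun_prop) h1 (fun _ => aemeasurable_const)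
  simpa [Function.id_def] using h2

/-- A centered normal limit is not affected by changes of sign. -/
lemma TendstoInDistribution.sign_mul {X : ℕ → Ω → ℝ} {v : ℝ≥0}
    (h : TendstoInDistribution X atTop (id : ℝ → ℝ) (fun _ => P) (gaussianReal 0 v))
    {s : ℕ → ℝ} (hs : ∀ᶠ m in atTop, s m = 1 ∨ s m = -1) :
    TendstoInDistribution (fun m ω => s m * X m ω) atTop (id : ℝ → ℝ) (fun _ => P)
      (gaussianReal 0 v) := by
  have hX := h.forall_aemeasurable
  rw [tendstoInDistribution_iff_integral (fun m => (hX m).const_mul (s m)) aemeasurable_id]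
  rw [tendstoInDistribution_iff_integral hX aemeasurable_id] at h
  intro F
  have h1 := h F
  have h2 := h (F.compContinuous ⟨fun x => -x, continuous_neg⟩)
  have h3 : ∫ x, (F.compContinuous ⟨fun x => -x, continuous_neg⟩) (id x) ∂(gaussianReal 0 v)
      = ∫ x, F (id x) ∂(gaussianReal 0 v) := by
    have h4 := integral_map (μ := gaussianReal 0 v) (φ := fun x : ℝ => -x)
      measurable_neg.aemeasurable F.continuous.measurable.aestronglyMeasurable
    rw [gaussianReal_map_neg, neg_zero] at h4
    exact h4.symm
  rw [h3] at h2
  rw [Metric.tendsto_nhds] at h1 h2 ⊢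
  intro ε hε
  filter_upwards [h1 ε hε, h2 ε hε, hs] with m e1 e2 e3
  rcases e3 with e3 | e3
  · simpa [e3] using e1
  · simpa [e3] using e2

end ConvergenceInDistribution

namespace MonitoringModel

/-! ### The noise of the detector -/

section Noise

variable {Ω : Type*} [MeasurableSpace Ω] (M : MonitoringModel Ω) (P : Measure Ω)

/-- The contribution of the monitoring sample before the change to the noise of the detector. -/
def preNoise (m : ℕ) (ω : Ω) : ℝ :=
  ∑ j ∈ Finset.Icc (m + 1) (m + M.kstar m), M.h2 P (M.Y (j : ℤ) ω)

/-- The contribution of the first `l` observations after the change to the noise. -/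
def postNoise (m l : ℕ) (ω : Ω) : ℝ :=
  ∑ j ∈ Finset.Icc (m + M.kstar m + 1) (m + M.kstar m + l), M.h2Star P m (M.Z m (j : ℤ) ω)

/-- The integer part of the delay between the change and its approximate detection. -/
def approxLag (m : ℕ) : ℕ := ⌊M.c m * √(m : ℝ) / |M.Delta P m|⌋₊

/-- The normalized noise at the approximate delay time. -/
def normalizedNoise (m : ℕ) (ω : Ω) : ℝ :=
  (M.preNoise P m ω + M.postNoise P m (M.approxLag P m) ω) / √(M.approxDelay P m)

variable {M P}

section Measurability

variable [IsProbabilityMeasure P]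

lemma measurable_h1 : Measurable (M.h1 P) := by
  refine StronglyMeasurable.measurable (StronglyMeasurable.integral_prod_right ?_)
  refine Measurable.stronglyMeasurable (Measurable.sub_const ?_ _)
  exact M.measurable_h.comp (measurable_fst.prodMk ((M.measurable_Y 1).comp measurable_snd))

lemma measurable_h1Star (m : ℕ) : Measurable (M.h1Star P m) := by
  refine StronglyMeasurable.measurable (StronglyMeasurable.integral_prod_right ?_)
  refine Measurable.stronglyMeasurable (Measurable.sub_const ?_ _)
  exact M.measurable_h.comp (measurable_fst.prodMk ((M.measurable_Z m 1).comp measurable_snd))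

lemma measurable_h2 : Measurable (M.h2 P) := by
  refine StronglyMeasurable.measurable (StronglyMeasurable.integral_prod_right ?_)
  refine Measurable.stronglyMeasurable (Measurable.sub_const ?_ _)
  exact M.measurable_h.comp (((M.measurable_Y 1).comp measurable_snd).prodMk measurable_fst)

lemma measurable_h2Star (m : ℕ) : Measurable (M.h2Star P m) := by
  refine StronglyMeasurable.measurable (StronglyMeasurable.integral_prod_right ?_)
  refine Measurable.stronglyMeasurable (Measurable.sub_const ?_ _)
  exact M.measurable_h.comp (((M.measurable_Y 1).comp measurable_snd).prodMk measurable_fst)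

lemma measurable_h2_Y (j : ℤ) : Measurable fun ω => M.h2 P (M.Y j ω) :=
  measurable_h2.comp (M.measurable_Y j)

lemma measurable_h2Star_Z (m : ℕ) (j : ℤ) : Measurable fun ω => M.h2Star P m (M.Z m j ω) :=
  (measurable_h2Star m).comp (M.measurable_Z m j)

lemma measurable_preNoise (m : ℕ) : Measurable (M.preNoise P m) :=
  Finset.measurable_sum _ fun _ _ => measurable_h2_Y _

lemma measurable_postNoise (m l : ℕ) : Measurable (M.postNoise P m l) :=
  Finset.measurable_sum _ fun _ _ => measurable_h2Star_Z m _

lemma measurable_normalizedNoise (m : ℕ) : Measurable (M.normalizedNoise P m) :=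
  ((measurable_preNoise m).add (measurable_postNoise m _)).div_const _

end Measurability

/-- The assumed maximal inequalities after the change, for unweighted maxima. -/
lemma AfterChange.partial_sums (h : M.AfterChange P) (k : ℕ → ℕ) (hk : Tendsto k atTop atTop) :
    IsBoundedInProbability P fun m ω => maxUpTo (k m) fun l => 1 / √(k m : ℝ) *
      |∑ j ∈ Finset.Icc (m + M.kstar m + 1) (m + M.kstar m + l),
        M.h2Star P m (M.Z m (j : ℤ) ω)| := by
  have := h.hajek_renyi 0 le_rfl (by norm_num) k hk
  simpa [Real.sqrt_eq_rpow] using this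

section Lag

variable (hc : M.ChangeMagnitude P) (ht : M.ThresholdAssumptions P)

include hc ht in
lemma tendsto_approxLag : Tendsto (M.approxLag P) atTop atTop :=
  tendsto_nat_floor_atTop.comp (tendsto_approxDelay_sub hc ht)

include ht in
lemma approxDelay_eq : ∀ᶠ m in atTop, (M.kstar m : ℝ) + M.approxLag P m ≤ M.approxDelay P m ∧
    M.approxDelay P m < (M.kstar m : ℝ) + M.approxLag P m + 1 := by
  filter_upwards [ht.c_pos] with m hm
  have h0 : 0 ≤ M.c m * √(m : ℝ) / |M.Delta P m| := by positivity
  have h1 := Nat.floor_le h0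
  have h2 := Nat.lt_floor_add_one (M.c m * √(m : ℝ) / |M.Delta P m|)
  unfold approxDelay approxLag
  constructor <;> linarith

include hc ht in
lemma tendsto_lag_div_approxDelay :
    Tendsto (fun m => ((M.kstar m : ℝ) + M.approxLag P m) / M.approxDelay P m) atTop (𝓝 1) := by
  have hA := tendsto_approxDelay hc ht
  have h1 := (tendsto_inv_atTop_zero.comp hA).const_sub 1
  rw [sub_zero] at h1
  refine tendsto_of_tendsto_of_tendsto_of_le_of_le' h1 tendsto_const_nhds ?_ ?_
  · filter_upwards [approxDelay_eq ht, hA.eventually_gt_atTop 0] with m h2 h3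
    rw [le_div_iff₀ h3, Function.comp, sub_mul, inv_mul_cancel₀ h3.ne']
    linarith
  · filter_upwards [approxDelay_eq ht, hA.eventually_gt_atTop 0] with m h2 h3
    exact (div_le_one h3).2 h2.1

end Lag

end Noise

end MonitoringModel

/-! ### The limit of the normalized noise -/

lemma sum_Icc_one_add (f : ℕ → ℝ) (p l : ℕ) :
    ∑ j ∈ Finset.Icc 1 (p + l), f j
      = ∑ j ∈ Finset.Icc 1 p, f j + ∑ j ∈ Finset.Icc (p + 1) (p + l), f j := by
  simpa only [zero_add] using sum_Icc_add_add f 0 p l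

lemma abs_sum_Icc_sub_sum_Icc (f : ℕ → ℝ) (k q : ℕ) :
    |∑ j ∈ Finset.Icc 1 k, f j - ∑ j ∈ Finset.Icc 1 q, f j|
      = |∑ j ∈ Finset.Icc (min k q + 1) (min k q + (max k q - min k q)), f j| := by
  rcases le_total k q with h | h
  · obtain ⟨l, rfl⟩ := Nat.exists_eq_add_of_le h
    rw [min_eq_left h, max_eq_right h, sum_Icc_one_add, abs_sub_comm]
    simp
  · obtain ⟨l, rfl⟩ := Nat.exists_eq_add_of_le h
    rw [min_eq_right h, max_eq_left h, sum_Icc_one_add]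
    simp

/-- The value at `t` of the first coordinate plus the increment of the second coordinate over
`[t, 1]` of a bivariate Wiener process is normally distributed. -/
lemma IsBivariateWiener.hasLaw_switch {Ω' : Type*} [MeasurableSpace Ω']
    {W : unitInterval → Ω' → ℝ × ℝ} {σ τ ρ : ℝ} {P' : Measure Ω'}
    (hW : IsBivariateWiener W σ τ ρ P') (t : unitInterval) :
    HasLaw (fun ω => (W t ω).1 + (W 1 ω).2 - (W t ω).2)
      (gaussianReal 0 ((t : ℝ) * σ ^ 2 + (1 - t) * τ ^ 2).toNNReal) P' := by
  have h1 := hW.gaussian_increments 0 t t.2.1 1 0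
  have h2 := hW.gaussian_increments t 1 t.2.2 0 1
  have hind := (hW.indep_increments.indepFun_sub_sub (r := 0) (s := t) (t := 1) t.2.1 t.2.2).comp
    measurable_fst measurable_snd
  have h1' : HasLaw (Prod.fst ∘ (W t - W 0)) (gaussianReal 0 ((t : ℝ) * σ ^ 2).toNNReal) P' := by
    convert h1 using 2
    · simp
    · congr 1; simp
  have h2' : HasLaw (Prod.snd ∘ (W 1 - W t))
      (gaussianReal 0 ((1 - (t : ℝ)) * τ ^ 2).toNNReal) P' := by
    convert h2 using 2
    · simp
    · congr 1; simp
  have h3 := IndepFun.hasLaw_add h1' h2' hind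
  rw [gaussianReal_conv_gaussianReal, add_zero, ← Real.toNNReal_add
    (mul_nonneg t.2.1 (sq_nonneg _)) (mul_nonneg (sub_nonneg.2 t.2.2) (sq_nonneg _))] at h3
  refine h3.congr ?_
  filter_upwards [hW.start_zero] with ω hω
  simp [hω]
  ring

namespace MonitoringModel

variable {Ω : Type*} [MeasurableSpace Ω] {M : MonitoringModel Ω} {P : Measure Ω}
  [IsProbabilityMeasure P]

lemma tendsto_window_Y (hb : M.BeforeChange P) (p : ℕ → ℕ) {n : ℕ → ℕ} {ν : ℕ → ℝ}
    (hν : Tendsto ν atTop atTop) (hn : Tendsto (fun m => (n m : ℝ) / ν m) atTop (𝓝 0))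
    {ε : ℝ} (hε : 0 < ε) :
    Tendsto (fun m => P.real {ω | ∃ l ≤ n m, ε * √(ν m) <
      |∑ j ∈ Finset.Icc (p m + 1) (p m + l), M.h2 P (M.Y (j : ℤ) ω)|}) atTop (𝓝 0) :=
  tendsto_measureReal_max_window (ξ := fun _ => M.Y) (fun _ => hb.stationary)
    (g := fun _ => M.h2 P) (fun _ => measurable_h2) (q := fun m => m) hb.partial_sums p hν hn hε

lemma tendsto_window_Z (ha : M.AfterChange P) (p : ℕ → ℕ) {n : ℕ → ℕ} {ν : ℕ → ℝ}
    (hν : Tendsto ν atTop atTop) (hn : Tendsto (fun m => (n m : ℝ) / ν m) atTop (𝓝 0))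
    {ε : ℝ} (hε : 0 < ε) :
    Tendsto (fun m => P.real {ω | ∃ l ≤ n m, ε * √(ν m) <
      |∑ j ∈ Finset.Icc (p m + 1) (p m + l), M.h2Star P m (M.Z m (j : ℤ) ω)|}) atTop (𝓝 0) :=
  tendsto_measureReal_max_window (ξ := M.Z) ha.stationary
    (g := M.h2Star P) measurable_h2Star (q := fun m => m + M.kstar m) ha.partial_sums p hν hn hε

/-- If almost all of the monitoring time is before the change, the noise is that of the first
series. -/
lemma tendstoInDistribution_normalizedNoise_of_later {σ : ℝ} (hc : M.ChangeMagnitude P)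
    (ht : M.ThresholdAssumptions P) (hb : M.BeforeChange P) (ha : M.AfterChange P)
    (hl : M.LaterChange P σ)
    (hprop : Tendsto (fun m => (M.kstar m : ℝ) / M.approxDelay P m) atTop (𝓝 1)) :
    TendstoInDistribution (M.normalizedNoise P) atTop (id : ℝ → ℝ) (fun _ => P)
      (gaussianReal 0 (σ ^ 2).toNNReal) := by
  have hA := tendsto_approxDelay hc ht
  have hk : Tendsto M.kstar atTop atTop := by
    have h1 : Tendsto (fun m => (M.kstar m : ℝ)) atTop atTop := by
      refine (hprop.pos_mul_atTop one_pos hA).congr' ?_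
      filter_upwards [hA.eventually_gt_atTop 0] with m hm
      field_simp
    exact tendsto_natCast_atTop_iff.1 h1
  have h1 := hl.clt _ hk
  have h2 : TendstoInDistribution (fun m ω => 1 / √(M.kstar m : ℝ) * M.preNoise P m ω) atTop
      (id : ℝ → ℝ) (fun _ => P) (gaussianReal 0 (σ ^ 2).toNNReal) := by
    refine TendstoInDistribution.congr_identDistrib h1 fun m => ?_
    have hg : Measurable fun x : ℤ → ℝ =>
        1 / √(M.kstar m : ℝ) * ∑ j ∈ Finset.Icc 1 (M.kstar m), M.h2 P (x (j : ℤ)) :=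
      Measurable.const_mul (Finset.measurable_sum _ fun j _ =>
        measurable_h2.comp (measurable_pi_apply _)) _
    have h3 := ((hb.stationary (m : ℤ)).comp hg).symm
    have hL : (fun ω => 1 / √(M.kstar m : ℝ) *
        ∑ j ∈ Finset.Icc 1 (M.kstar m), M.h2 P (M.Y (j : ℤ) ω))
        = (fun x : ℤ → ℝ => 1 / √(M.kstar m : ℝ) *
          ∑ j ∈ Finset.Icc 1 (M.kstar m), M.h2 P (x (j : ℤ))) ∘ (fun ω i => M.Y i ω) := rfl
    rw [hL]
    convert h3 using 1
    funext ω
    simp only [preNoise, Function.comp]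
    have e := sum_Icc_add (fun j : ℕ => M.h2 P (M.Y ((j : ℤ) + m) ω)) 0 (M.kstar m)
    rw [zero_add, zero_add] at e
    rw [e, sum_Icc_add]
    congr 1
    refine Finset.sum_congr rfl fun i _ => ?_
    congr 2
    push_cast
    ring
  have h3 := TendstoInDistribution.const_seq_mul h2
    (a := fun m => √((M.kstar m : ℝ) / M.approxDelay P m)) (by simpa using hprop.sqrt)
  refine tendstoInDistribution_of_tendstoInMeasure_sub _ _ h3
    (tendstoInMeasure_zero_of_measureReal fun ε hε => ?_)
    fun m => (measurable_normalizedNoise m).aemeasurable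
  have hlag : Tendsto (fun m => (M.approxLag P m : ℝ) / M.approxDelay P m) atTop (𝓝 0) := by
    have := (tendsto_lag_div_approxDelay hc ht).sub hprop
    rw [sub_self] at this
    refine this.congr fun m => ?_
    ring
  refine squeeze_zero' (Eventually.of_forall fun _ => measureReal_nonneg) ?_
    (tendsto_window_Z ha (fun m => m + M.kstar m) hA hlag hε)
  filter_upwards [hk.eventually_gt_atTop 0, hA.eventually_gt_atTop 0] with m hk0 hA0
  refine measureReal_mono fun ω hω => ⟨M.approxLag P m, le_rfl, ?_⟩
  have hk1 : √(M.kstar m : ℝ) ≠ 0 := (Real.sqrt_pos.2 (by exact_mod_cast hk0)).ne'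
  have hA1 : 0 < √(M.approxDelay P m) := Real.sqrt_pos.2 hA0
  simp only [Set.mem_ofPred_eq, Pi.sub_apply, normalizedNoise] at hω
  have e : (M.preNoise P m ω + M.postNoise P m (M.approxLag P m) ω) / √(M.approxDelay P m)
      - √((M.kstar m : ℝ) / M.approxDelay P m) * (1 / √(M.kstar m : ℝ) * M.preNoise P m ω)
      = M.postNoise P m (M.approxLag P m) ω / √(M.approxDelay P m) := by
    rw [Real.sqrt_div' _ hA0.le]
    field_simp
    ring
  rw [e, abs_div, abs_of_pos hA1, lt_div_iff₀ hA1] at hω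
  exact hω

/-- If a non-negligible part of the monitoring time is after the change, the noise is, up to
negligible terms, a continuous functional of the bivariate partial sum path. -/
lemma tendstoInDistribution_normalizedNoise_of_early {σ τ : ℝ} (hc : M.ChangeMagnitude P)
    (ht : M.ThresholdAssumptions P) (hb : M.BeforeChange P) (ha : M.AfterChange P)
    (he : M.VeryEarlyChange P σ τ) {t : ℝ} (ht01 : t ∈ Set.Icc (0 : ℝ) 1)
    (hprop : Tendsto (fun m => (M.kstar m : ℝ) / M.approxDelay P m) atTop (𝓝 t)) :
    TendstoInDistribution (M.normalizedNoise P) atTop (id : ℝ → ℝ) (fun _ => P)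
      (gaussianReal 0 (t * σ ^ 2 + (1 - t) * τ ^ 2).toNNReal) := by
  have hA := tendsto_approxDelay hc ht
  set n : ℕ → ℕ := fun m => M.kstar m + M.approxLag P m with hn
  have hn_top : Tendsto n atTop atTop :=
    tendsto_atTop_mono (fun m => Nat.le_add_left _ _) (tendsto_approxLag hc ht)
  have hnA : Tendsto (fun m => (n m : ℝ) / M.approxDelay P m) atTop (𝓝 1) := by
    refine (tendsto_lag_div_approxDelay hc ht).congr fun m => ?_
    simp [hn]
  have hn_real : Tendsto (fun m => (n m : ℝ)) atTop atTop :=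
    tendsto_natCast_atTop_atTop.comp hn_top
  have hkn : Tendsto (fun m => (M.kstar m : ℝ) / n m) atTop (𝓝 t) := by
    have := hprop.div hnA one_ne_zero
    rw [div_one] at this
    refine this.congr' ?_
    filter_upwards [hA.eventually_gt_atTop 0, hn_real.eventually_gt_atTop 0] with m h1 h2
    simp only [Pi.div_apply]
    field_simp
  set q : ℕ → ℕ := fun m => ⌊(n m : ℝ) * t⌋₊ with hq
  -- a continuous functional of the partial sum path
  set G : ℕ → Ω → ℝ := fun m ω => 1 / √(n m : ℝ) *
    (∑ j ∈ Finset.Icc 1 (q m), M.h2 P (M.Y (j : ℤ) ω)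
      + ∑ j ∈ Finset.Icc 1 (n m), M.h2Star P m (M.Z m (j : ℤ) ω)
      - ∑ j ∈ Finset.Icc 1 (q m), M.h2Star P m (M.Z m (j : ℤ) ω)) with hG
  have hGm : ∀ m, Measurable (G m) := fun m =>
    (((Finset.measurable_sum _ fun j _ => measurable_h2_Y _).add
      (Finset.measurable_sum _ fun j _ => measurable_h2Star_Z m _)).sub
      (Finset.measurable_sum _ fun j _ => measurable_h2Star_Z m _)).const_mul _
  have hGlim : TendstoInDistribution G atTop (id : ℝ → ℝ) (fun _ => P)
      (gaussianReal 0 (t * σ ^ 2 + (1 - t) * τ ^ 2).toNNReal) := by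
    rw [tendstoInDistribution_iff_integral (fun m => (hGm m).aemeasurable) aemeasurable_id]
    obtain ⟨Ω', _, P', _, W, ρ, hW, hlim⟩ := he.fclt
    intro F
    set t' : unitInterval := ⟨t, ht01⟩ with ht'
    have hev : ∀ s : unitInterval,
        Continuous fun f : unitInterval →ᵤ ℝ × ℝ => UniformFun.toFun f s := fun s =>
      (UniformFun.uniformContinuous_eval (ℝ × ℝ) s).continuous
    set Φ : C(unitInterval →ᵤ ℝ × ℝ, ℝ) := ⟨fun f => (UniformFun.toFun f t').1
      + (UniformFun.toFun f 1).2 - (UniformFun.toFun f t').2,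
      (((hev t').fst).add (hev 1).snd).sub (hev t').snd⟩ with hΦ
    have h1 := hlim n hn_top (F.compContinuous Φ)
    have h2 := (hW.hasLaw_switch t').integral_comp (f := F)
      F.continuous.measurable.aestronglyMeasurable
    have h3 : ∫ ω, (F.compContinuous Φ) (UniformFun.ofFun fun s => W s ω) ∂P'
        = ∫ x, F (id x) ∂(gaussianReal 0 (t * σ ^ 2 + (1 - t) * τ ^ 2).toNNReal) := h2
    rw [h3] at h1
    refine h1.congr fun m => integral_congr_ae (Eventually.of_forall fun ω => ?_)
    change F (Φ _) = F (G m ω)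
    congr 1
    change (UniformFun.toFun (partialSumPath _ (n m) ω) t').1
      + (UniformFun.toFun (partialSumPath _ (n m) ω) 1).2
      - (UniformFun.toFun (partialSumPath _ (n m) ω) t').2 = G m ω
    simp only [partialSumPath, UniformFun.toFun_ofFun, hG, hq, ht']
    simp only [Prod.smul_fst, Prod.smul_snd, Prod.fst_sum, Prod.snd_sum, smul_eq_mul,
      Set.Icc.coe_one, mul_one, Nat.floor_natCast]
    ring
  -- the noise, shifted to the start of the series; it differs from `G` by two windows between `k*`
  -- and `q`
  set V : ℕ → Ω → ℝ := fun m ω => 1 / √(n m : ℝ) *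
    (∑ j ∈ Finset.Icc 1 (M.kstar m), M.h2 P (M.Y (j : ℤ) ω)
      + ∑ j ∈ Finset.Icc 1 (n m), M.h2Star P m (M.Z m (j : ℤ) ω)
      - ∑ j ∈ Finset.Icc 1 (M.kstar m), M.h2Star P m (M.Z m (j : ℤ) ω)) with hV
  have hVm : ∀ m, Measurable (V m) := fun m =>
    (((Finset.measurable_sum _ fun j _ => measurable_h2_Y _).add
      (Finset.measurable_sum _ fun j _ => measurable_h2Star_Z m _)).sub
      (Finset.measurable_sum _ fun j _ => measurable_h2Star_Z m _)).const_mul _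
  have hVlim : TendstoInDistribution V atTop (id : ℝ → ℝ) (fun _ => P)
      (gaussianReal 0 (t * σ ^ 2 + (1 - t) * τ ^ 2).toNNReal) := by
    refine tendstoInDistribution_of_tendstoInMeasure_sub _ _ hGlim
      (tendstoInMeasure_zero_of_measureReal fun ε hε => ?_) fun m => (hVm m).aemeasurable
    have hwin : Tendsto (fun m => ((max (M.kstar m) (q m) - min (M.kstar m) (q m) : ℕ) : ℝ) / n m)
        atTop (𝓝 0) := by
      have e1 : Tendsto (fun m => (q m : ℝ) / n m) atTop (𝓝 t) := by
        have := (tendsto_nat_floor_mul_div_atTop (R := ℝ) ht01.1).comp hn_real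
        refine this.congr fun m => ?_
        simp [hq, mul_comm]
      have e2 := (hkn.sub e1).abs
      rw [sub_self, abs_zero] at e2
      refine e2.congr fun m => ?_
      rw [← sub_div, abs_div, Nat.abs_cast]
      congr 1
      rcases le_total (M.kstar m) (q m) with h | h
      · rw [max_eq_right h, min_eq_left h, Nat.cast_sub h, abs_sub_comm, abs_of_nonneg]
        exact sub_nonneg.2 (by exact_mod_cast h)
      · rw [max_eq_left h, min_eq_right h, Nat.cast_sub h, abs_of_nonneg]
        exact sub_nonneg.2 (by exact_mod_cast h)
    have hsum := (tendsto_window_Y hb (fun m => min (M.kstar m) (q m)) hn_real hwin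
      (half_pos hε)).add (tendsto_window_Z ha (fun m => min (M.kstar m) (q m)) hn_real hwin
      (half_pos hε))
    rw [add_zero] at hsum
    refine squeeze_zero' (Eventually.of_forall fun _ => measureReal_nonneg) ?_ hsum
    filter_upwards [hn_real.eventually_gt_atTop 0] with m hm
    refine (measureReal_mono ?_).trans (measureReal_union_le _ _)
    intro ω hω
    have hs : 0 < √(n m : ℝ) := Real.sqrt_pos.2 hm
    by_contra hcon
    simp only [Set.mem_union, Set.mem_ofPred_eq, not_or, not_exists, not_and, not_lt] at hcon
    have c1 := hcon.1 _ le_rfl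
    have c2 := hcon.2 _ le_rfl
    rw [← abs_sum_Icc_sub_sum_Icc (fun j : ℕ => M.h2 P (M.Y (j : ℤ) ω))] at c1
    rw [← abs_sum_Icc_sub_sum_Icc (fun j : ℕ => M.h2Star P m (M.Z m (j : ℤ) ω))] at c2
    simp only [Set.mem_ofPred_eq, Pi.sub_apply, hV, hG, ← mul_sub] at hω
    rw [abs_mul, abs_of_pos (by positivity), one_div, inv_mul_eq_div, lt_div_iff₀ hs] at hω
    rw [abs_le] at c1 c2
    refine absurd hω (not_lt.2 (abs_le.2 ⟨?_, ?_⟩)) <;> linarith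
  have hVA := TendstoInDistribution.const_seq_mul hVlim
    (a := fun m => √((n m : ℝ) / M.approxDelay P m)) (by simpa using hnA.sqrt)
  refine TendstoInDistribution.congr_identDistrib
    (X := fun m ω => √((n m : ℝ) / M.approxDelay P m) * V m ω) hVA fun m => ?_
  have hg : Measurable fun x : ℤ → ℝ × ℝ => √((n m : ℝ) / M.approxDelay P m) * (1 / √(n m : ℝ) *
      (∑ j ∈ Finset.Icc 1 (M.kstar m), M.h2 P (x (j : ℤ)).1
        + ∑ j ∈ Finset.Icc 1 (n m), M.h2Star P m (x (j : ℤ)).2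
        - ∑ j ∈ Finset.Icc 1 (M.kstar m), M.h2Star P m (x (j : ℤ)).2)) := by
    have e1 : ∀ j : ℤ, Measurable fun x : ℤ → ℝ × ℝ => M.h2 P (x j).1 := fun j =>
      measurable_h2.comp (measurable_pi_apply j).fst
    have e2 : ∀ j : ℤ, Measurable fun x : ℤ → ℝ × ℝ => M.h2Star P m (x j).2 := fun j =>
      (measurable_h2Star m).comp (measurable_pi_apply j).snd
    exact ((((Finset.measurable_sum _ fun j _ => e1 _).add
      (Finset.measurable_sum _ fun j _ => e2 _)).sub
      (Finset.measurable_sum _ fun j _ => e2 _)).const_mul _).const_mul _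
  have h3 := ((he.jointly_stationary m (m : ℤ)).comp hg).symm
  have hL : (fun ω => √((n m : ℝ) / M.approxDelay P m) * V m ω)
      = (fun x : ℤ → ℝ × ℝ => √((n m : ℝ) / M.approxDelay P m) * (1 / √(n m : ℝ) *
      (∑ j ∈ Finset.Icc 1 (M.kstar m), M.h2 P (x (j : ℤ)).1
        + ∑ j ∈ Finset.Icc 1 (n m), M.h2Star P m (x (j : ℤ)).2
        - ∑ j ∈ Finset.Icc 1 (M.kstar m), M.h2Star P m (x (j : ℤ)).2))) ∘
        (fun ω i => (M.Y i ω, M.Z m i ω)) := rfl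
  rw [hL]
  convert h3 using 1
  funext ω
  simp only [Function.comp, normalizedNoise, hn]
  rw [sum_Icc_one_add, add_sub_assoc, add_sub_cancel_left]
  have f1 : M.preNoise P m ω
      = ∑ j ∈ Finset.Icc 1 (M.kstar m), M.h2 P (M.Y ((j : ℤ) + m) ω) := by
    have e := sum_Icc_add (fun j : ℕ => M.h2 P (M.Y ((j : ℤ) + m) ω)) 0 (M.kstar m)
    rw [zero_add, zero_add] at e
    rw [e, preNoise, sum_Icc_add]
    refine Finset.sum_congr rfl fun i _ => ?_
    congr 2
    push_cast
    ring
  have f2 : M.postNoise P m (M.approxLag P m) ω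
      = ∑ j ∈ Finset.Icc (M.kstar m + 1) (M.kstar m + M.approxLag P m),
        M.h2Star P m (M.Z m ((j : ℤ) + m) ω) := by
    rw [sum_Icc_add, postNoise, sum_Icc_add]
    refine Finset.sum_congr rfl fun i _ => ?_
    congr 2
    push_cast
    ring
  rw [← f1, ← f2, Real.sqrt_div (Nat.cast_nonneg _)]
  rcases Nat.eq_zero_or_pos (M.kstar m + M.approxLag P m) with h0 | h0
  · have g1 : M.kstar m = 0 := by omega
    have g2 : M.approxLag P m = 0 := by omega
    simp [preNoise, postNoise, g1, g2]
  · have : √((M.kstar m + M.approxLag P m : ℕ) : ℝ) ≠ 0 :=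
      (Real.sqrt_pos.2 (by exact_mod_cast h0)).ne'
    field_simp

end MonitoringModel

/-! ### The remainder of the Hoeffding decomposition -/

/-- The powers of two in the maximal inequality cost only a logarithmic factor. -/
lemma eventually_clog_le {n : ℕ → ℕ} {p : ℕ} (hn : ∀ᶠ m : ℕ in atTop, (n m : ℝ) ≤ (m : ℝ) ^ p)
    (hn0 : ∀ᶠ m : ℕ in atTop, 0 < n m) :
    ∀ᶠ m : ℕ in atTop, n m ≤ 2 ^ Nat.clog 2 (n m) ∧ (2 : ℝ) ^ Nat.clog 2 (n m) ≤ 2 * n m ∧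
      (Nat.clog 2 (n m) : ℝ) + 1 ≤ (4 + 2 * p) * Real.log m := by
  have hlog : ∀ᶠ m : ℕ in atTop, 1 ≤ Real.log m :=
    (Real.tendsto_log_atTop.comp tendsto_natCast_atTop_atTop).eventually_ge_atTop 1
  filter_upwards [hn, hn0, hlog, eventually_gt_atTop 0] with m h1 h2 h3 h4
  have e1 : (2 : ℝ) ^ Nat.clog 2 (n m) ≤ 2 * n m := by
    rcases Nat.lt_or_ge (n m) 2 with h | h
    · have : n m = 1 := by omega
      rw [this]
      simp
    · have h5 := Nat.pow_pred_clog_lt_self (b := 2) (by norm_num) h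
      have h6 : 0 < Nat.clog 2 (n m) := Nat.clog_pos (by norm_num) h
      have h7 : 2 ^ Nat.clog 2 (n m) = 2 * 2 ^ (Nat.clog 2 (n m)).pred := by
        rw [← pow_succ', ← Nat.succ_eq_add_one, Nat.succ_pred_eq_of_pos h6]
      have h8 : 2 ^ Nat.clog 2 (n m) ≤ 2 * n m := by rw [h7]; omega
      exact_mod_cast h8
  refine ⟨Nat.le_pow_clog (by norm_num) _, e1, ?_⟩
  have hm : (0 : ℝ) < m := by exact_mod_cast h4
  have e2 : (2 : ℝ) ^ Nat.clog 2 (n m) ≤ 2 * (m : ℝ) ^ p := e1.trans (by gcongr)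
  have e3 := Real.log_le_log (by positivity) e2
  rw [Real.log_pow, Real.log_mul (by norm_num) (by positivity), Real.log_pow] at e3
  have e4 := Real.log_two_gt_d9
  have e5 := Real.log_two_lt_d9
  have e6 : (0 : ℝ) ≤ Nat.clog 2 (n m) := Nat.cast_nonneg _
  have e7 : (Nat.clog 2 (n m) : ℝ) ≤ 2 * (1 + p * Real.log m) := by nlinarith
  linarith

section Remainder

variable {Ω : Type*} [MeasurableSpace Ω] {P : Measure Ω} [IsProbabilityMeasure P]

/-- Sums of remainder terms are uniformly negligible over polynomially many summands, by the
maximal inequality. -/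
lemma tendsto_measureReal_max_remainder {f : ℕ → ℕ → ℕ → Ω → ℝ}
    (hf : ∀ m i j, Measurable (f m i j)) {u : ℕ → ℝ}
    (hmom : ∀ m k₁ k₂ : ℕ, m + 1 ≤ k₁ → k₁ ≤ k₂ →
      ∫⁻ ω, ENNReal.ofReal (|∑ i ∈ Finset.Icc 1 m, ∑ j ∈ Finset.Icc k₁ k₂, f m i j ω| ^ 2) ∂P
        ≤ ENNReal.ofReal (u m * ((k₂ : ℝ) - (k₁ : ℝ) + 1)))
    (hu : Tendsto (fun m : ℕ => u m / (m : ℝ) ^ 2 * Real.log (m : ℝ) ^ 2) atTop (𝓝 0))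
    {q : ℕ → ℕ} (hq : ∀ m, m ≤ q m) {n : ℕ → ℕ} {p : ℕ} {ν : ℕ → ℝ} (hν : Tendsto ν atTop atTop)
    {K : ℝ} (hn : ∀ᶠ m : ℕ in atTop, (n m : ℝ) ≤ (m : ℝ) ^ p)
    (hnν : ∀ᶠ m : ℕ in atTop, (n m : ℝ) ≤ K * ν m) (hn0 : ∀ᶠ m : ℕ in atTop, 0 < n m)
    {ε : ℝ} (hε : 0 < ε) :
    Tendsto (fun m => P.real {ω | ∃ l ≤ n m, ε * √(ν m) < |1 / (m : ℝ) *
      ∑ i ∈ Finset.Icc 1 m, ∑ j ∈ Finset.Icc (q m + 1) (q m + l), f m i j ω|}) atTop (𝓝 0) := by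
  -- `u m` may be negative, so its absolute value is used in the maximal inequality
  have hlim : Tendsto (fun m : ℕ => (4 + 2 * (p : ℝ)) ^ 2 * (2 * K) / ε ^ 2 *
      |u m / (m : ℝ) ^ 2 * Real.log (m : ℝ) ^ 2|) atTop (𝓝 0) := by
    simpa using hu.abs.const_mul ((4 + 2 * (p : ℝ)) ^ 2 * (2 * K) / ε ^ 2)
  refine squeeze_zero' (Eventually.of_forall fun _ => measureReal_nonneg) ?_ hlim
  filter_upwards [eventually_clog_le hn hn0, hnν, hν.eventually_gt_atTop 0,
    eventually_gt_atTop 0] with m ⟨h1, h2, h3⟩ h4 h5 h6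
  have hm : (0 : ℝ) < m := by exact_mod_cast h6
  have hs : 0 < √(ν m) := Real.sqrt_pos.2 h5
  set x : ℕ → Ω → ℝ := fun j ω => ∑ i ∈ Finset.Icc 1 m, f m i (q m + 1 + j) ω with hx
  have hxsum : ∀ a l ω, ∑ t ∈ Finset.range l, x (a + t) ω
      = ∑ i ∈ Finset.Icc 1 m, ∑ j ∈ Finset.Icc (q m + a + 1) (q m + a + l), f m i j ω := by
    intro a l ω
    rw [hx, Finset.sum_comm]
    refine Finset.sum_congr rfl fun i _ => ?_
    rw [sum_Icc_add]
    refine Finset.sum_congr rfl fun t _ => ?_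
    congr 1
    omega
  have hxmom : ∀ a l : ℕ, ∫⁻ ω, ENNReal.ofReal ((∑ t ∈ Finset.range l, x (a + t) ω) ^ 2) ∂P
      ≤ ENNReal.ofReal (|u m| * l) := by
    intro a l
    rcases Nat.eq_zero_or_pos l with rfl | hl
    · simp
    simp_rw [hxsum, ← sq_abs (∑ i ∈ Finset.Icc 1 m, _)]
    refine (hmom m _ _ (by have := hq m; omega) (by omega)).trans (ENNReal.ofReal_le_ofReal ?_)
    have : ((q m + a + l : ℕ) : ℝ) - ((q m + a + 1 : ℕ) : ℝ) + 1 = l := by push_cast; ring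
    rw [this]
    gcongr
    exact le_abs_self _
  have hmax := measureReal_max_sum_le (P := P) (x := x)
    (fun j => Finset.measurable_sum _ fun i _ => hf _ _ _) (abs_nonneg (u m)) hxmom
    (Nat.clog 2 (n m)) (c := m * (ε * √(ν m))) (by positivity)
  refine (measureReal_mono ?_).trans (hmax.trans ?_)
  · rintro ω ⟨l, hl, hlt⟩
    refine ⟨l, hl.trans h1, ?_⟩
    have := hxsum 0 l ω
    simp only [zero_add, add_zero] at this
    rw [this]
    rw [abs_mul, abs_of_pos (by positivity), one_div, inv_mul_eq_div, lt_div_iff₀ hm] at hlt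
    linarith
  · have hK : 0 ≤ K := by
      have : (0 : ℝ) ≤ n m := Nat.cast_nonneg _
      by_contra hneg
      nlinarith [not_le.1 hneg]
    have hlog : 0 ≤ Real.log m := Real.log_natCast_nonneg m
    calc ((Nat.clog 2 (n m) : ℝ) + 1) ^ 2 * |u m| * 2 ^ Nat.clog 2 (n m) / (m * (ε * √(ν m))) ^ 2
        ≤ ((4 + 2 * p) * Real.log m) ^ 2 * |u m| * (2 * (K * ν m)) / (m * (ε * √(ν m))) ^ 2 := by
          gcongr
          linarith
      _ = ((4 + 2 * p) * Real.log m) ^ 2 * |u m| * (2 * (K * ν m))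
            / (m ^ 2 * (ε ^ 2 * ν m)) := by
          rw [mul_pow (m : ℝ), mul_pow ε, Real.sq_sqrt h5.le]
      _ = (4 + 2 * (p : ℝ)) ^ 2 * (2 * K) / ε ^ 2 * (|u m| / (m : ℝ) ^ 2 * Real.log m ^ 2) := by
          field_simp
      _ = _ := by
          rw [abs_mul, abs_div, abs_of_nonneg (sq_nonneg (m : ℝ)),
            abs_of_nonneg (sq_nonneg (Real.log (m : ℝ)))]

end Remainder

namespace MonitoringModel

variable {Ω : Type*} [MeasurableSpace Ω] (M : MonitoringModel Ω) (P : Measure Ω)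

/-- The remainder term of the detector from the observations before the change. -/
def preRemainder (m : ℕ) (ω : Ω) : ℝ :=
  1 / (m : ℝ) * ∑ i ∈ Finset.Icc 1 m, ∑ j ∈ Finset.Icc (m + 1) (m + M.kstar m),
    M.r P (M.Y (i : ℤ) ω) (M.Y (j : ℤ) ω)

/-- The remainder term of the detector from the first `l` observations after the change. -/
def postRemainder (m l : ℕ) (ω : Ω) : ℝ :=
  1 / (m : ℝ) * ∑ i ∈ Finset.Icc 1 m,
    ∑ j ∈ Finset.Icc (m + M.kstar m + 1) (m + M.kstar m + l),
      M.rStar P m (M.Y (i : ℤ) ω) (M.Z m (j : ℤ) ω)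

/-- The part of the detector at time `k > k*` that does not depend on the drift. -/
def noise (m k : ℕ) (ω : Ω) : ℝ :=
  M.preNoise P m ω + M.postNoise P m (k - M.kstar m) ω
    + (M.preRemainder P m ω + M.postRemainder P m (k - M.kstar m) ω)

variable {M P}

lemma measurable_r_comp [IsProbabilityMeasure P] (i j : ℤ) :
    Measurable fun ω => M.r P (M.Y i ω) (M.Y j ω) :=
  (((M.measurable_h.comp ((M.measurable_Y i).prodMk (M.measurable_Y j))).sub
    (measurable_h1.comp (M.measurable_Y i))).sub
    (measurable_h2.comp (M.measurable_Y j))).sub_const _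

lemma measurable_rStar_comp [IsProbabilityMeasure P] (m : ℕ) (i j : ℤ) :
    Measurable fun ω => M.rStar P m (M.Y i ω) (M.Z m j ω) :=
  (((M.measurable_h.comp ((M.measurable_Y i).prodMk (M.measurable_Z m j))).sub
    ((measurable_h1Star m).comp (M.measurable_Y i))).sub
    ((measurable_h2Star m).comp (M.measurable_Z m j))).sub_const _

/-- Decomposition of the detector into drift and noise after the change point. -/
lemma Gam_eq_detectorPath {m : ℕ} (hm : 0 < m) {k : ℕ} (hk : M.kstar m < k) (ω : Ω) :
    M.Gam P m k ω = detectorPath (M.kstar m) (M.S1 P m ω) (M.S1Star P m ω)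
      (Real.sign (M.Delta P m)) (√(m : ℝ)) |M.Delta P m| (fun k => M.noise P m k ω) k := by
  obtain ⟨l, rfl⟩ := Nat.exists_eq_add_of_le hk.le
  have hm0 : (0 : ℝ) < m := by exact_mod_cast hm
  have hρ : 0 < √(m : ℝ) := Real.sqrt_pos.2 hm0
  have hsign : Real.sign (M.Delta P m) * |M.Delta P m| = M.Delta P m := by
    rcases lt_trichotomy (M.Delta P m) 0 with h | h | h
    · rw [Real.sign_of_neg h, abs_of_neg h]
      ring
    · rw [h]
      simp
    · rw [Real.sign_of_pos h, abs_of_pos h, one_mul]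
  -- the historic observations `X m i`, `i ≤ m`, always belong to the first series
  have hinner : ∀ i ∈ Finset.Icc 1 m, ∑ j ∈ Finset.Icc (m + 1) (m + (M.kstar m + l)),
      (M.h (M.X m i ω) (M.X m j ω) - M.theta P)
      = (M.kstar m : ℝ) * M.h1 P (M.Y (i : ℤ) ω) + l * M.h1Star P m (M.Y (i : ℤ) ω)
        + (M.preNoise P m ω + M.postNoise P m l ω + l * M.Delta P m)
        + ∑ j ∈ Finset.Icc (m + 1) (m + M.kstar m), M.r P (M.Y (i : ℤ) ω) (M.Y (j : ℤ) ω)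
        + ∑ j ∈ Finset.Icc (m + M.kstar m + 1) (m + M.kstar m + l),
            M.rStar P m (M.Y (i : ℤ) ω) (M.Z m (j : ℤ) ω) := by
    intro i hi
    have hi' := Finset.mem_Icc.1 hi
    have hXi : M.X m i ω = M.Y (i : ℤ) ω := if_pos (by omega)
    rw [← add_assoc, sum_Icc_add_add, hXi]
    have e1 : ∀ j ∈ Finset.Icc (m + 1) (m + M.kstar m),
        M.h (M.Y (i : ℤ) ω) (M.X m j ω) - M.theta P
        = M.h1 P (M.Y (i : ℤ) ω) + M.h2 P (M.Y (j : ℤ) ω)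
          + M.r P (M.Y (i : ℤ) ω) (M.Y (j : ℤ) ω) := by
      intro j hj
      have hj' := Finset.mem_Icc.1 hj
      rw [show M.X m j ω = M.Y (j : ℤ) ω from if_pos (by omega), r]
      ring
    have e2 : ∀ j ∈ Finset.Icc (m + M.kstar m + 1) (m + M.kstar m + l),
        M.h (M.Y (i : ℤ) ω) (M.X m j ω) - M.theta P
        = (M.h1Star P m (M.Y (i : ℤ) ω) + M.Delta P m) + M.h2Star P m (M.Z m (j : ℤ) ω)
          + M.rStar P m (M.Y (i : ℤ) ω) (M.Z m (j : ℤ) ω) := by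
      intro j hj
      have hj' := Finset.mem_Icc.1 hj
      rw [show M.X m j ω = M.Z m (j : ℤ) ω from if_neg (by omega), rStar, Delta]
      ring
    rw [Finset.sum_congr rfl e1, Finset.sum_congr rfl e2]
    simp only [Finset.sum_add_distrib, Finset.sum_const, Nat.card_Icc, nsmul_eq_mul, preNoise,
      postNoise]
    have c1 : m + M.kstar m + 1 - (m + 1) = M.kstar m := by omega
    have c2 : m + M.kstar m + l + 1 - (m + M.kstar m + 1) = l := by omega
    rw [c1, c2]
    ring
  unfold Gam detectorPath noise
  rw [Finset.sum_congr rfl hinner, hsign]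
  simp only [Nat.add_sub_cancel_left, Finset.sum_add_distrib, ← Finset.mul_sum,
    Finset.sum_const, Nat.card_Icc, nsmul_eq_mul, preRemainder, postRemainder, S1, S1Star,
    Nat.add_sub_cancel]
  have hsq : √(m : ℝ) * √(m : ℝ) = m := Real.mul_self_sqrt hm0.le
  have d1 : ∀ x : ℝ, 1 / √(m : ℝ) * x / √(m : ℝ) = x / m := by
    intro x
    rw [one_div, inv_mul_eq_div, div_div, hsq]
  rw [d1, d1]
  push_cast
  field_simp
  ring

lemma lt_weight_mul_iff {m : ℕ} (hm : 0 < m) (k : ℕ) (c x : ℝ) :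
    c < weight m k * x ↔ c * (√(m : ℝ) + k / √(m : ℝ)) < x := by
  have hm0 : (0 : ℝ) < m := by exact_mod_cast hm
  have hρ : 0 < √(m : ℝ) := Real.sqrt_pos.2 hm0
  have hsq : √(m : ℝ) * √(m : ℝ) = m := Real.mul_self_sqrt hm0.le
  have e : √(m : ℝ) * (1 + (k : ℝ) / (m : ℝ)) = √(m : ℝ) + k / √(m : ℝ) := by
    rw [mul_add, mul_one]
    congr 1
    nth_rewrite 2 [← hsq]
    field_simp
  rw [weight, e, inv_mul_eq_div, lt_div_iff₀ (by positivity)]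

end MonitoringModel

namespace MonitoringModel

/-! ### The detector on events of high probability -/

section GoodEvents

variable {Ω : Type*} [MeasurableSpace Ω] {M : MonitoringModel Ω} {P : Measure Ω}

/-- All deterministic requirements on a regular path hold for large samples. -/
lemma eventually_regularPath (hc : M.ChangeMagnitude P) (ht : M.ThresholdAssumptions P)
    {ε C : ℝ} (hε : 0 < ε) (hε1 : ε ≤ 1) (hC : 1 ≤ C) :
    ∀ᶠ m in atTop, ∀ (S S' V : ℝ) (N : ℕ → ℝ), |S| ≤ C → |S'| ≤ C → |V| ≤ C →
      (∀ k : ℕ, M.kstar m < k → (k : ℝ) ≤ 2 * M.approxDelay P m →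
        |N k| ≤ C * √(M.approxDelay P m)) →
      (∀ k : ℕ, M.kstar m < k →
        |(k : ℝ) - M.approxDelay P m| ≤ M.windowWidth P m * M.approxDelay P m →
        |Real.sign (M.Delta P m) * N k - V * √(M.approxDelay P m)|
          ≤ ε / 4 * √(M.approxDelay P m)) →
      RegularPath (M.kstar m) S S' (Real.sign (M.Delta P m)) (M.c m) (√(m : ℝ)) |M.Delta P m| V N
        ε C (M.windowWidth P m) (M.approxDelay P m) := by
  have hw := tendsto_windowWidth hc ht
  have hCpos : 0 < C := by linarith
  filter_upwards [eventually_gt_atTop 0, ht.c_pos, hc.abs_Delta_pos, windowWidth_pos hc ht,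
    hw.eventually (ge_mem_nhds (by norm_num : (0 : ℝ) < 1 / 2)),
    mul_relError_le_windowWidth hc ht (16 * C),
    hw.eventually (ge_mem_nhds (by positivity : (0 : ℝ) < ε / (C + 3))),
    (tendsto_windowWidth_mul_signalToNoise hc ht).eventually_ge_atTop (8 * (C + 1)),
    (tendsto_windowWidth_mul_approxDelay hc ht).eventually_ge_atTop 4,
    Delta_le_mul_sqrt_approxDelay hc ht hε,
    mul_sqrt_approxDelay_le hc ht (by positivity : 0 < 16 * (C + 1)),
    mul_kstar_div_le ht (2 * C)]
    with m h1 h2 h3 h4 h5 h6 h7 h8 h9 h10 h11 h12 S S' V N hS hS' hV hN hW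
  rw [le_div_iff₀ (by positivity)] at h7
  exact
    { A_eq := rfl
      rho_pos := Real.sqrt_pos.2 (by exact_mod_cast h1)
      c_pos := h2
      d_pos := h3
      s_sq := by
        rcases Real.sign_apply_eq_of_ne_zero _ (abs_pos.1 h3) with h | h <;> rw [h] <;> norm_num
      eps_pos := hε
      eps_le := hε1
      C_ge := hC
      delta_pos := h4
      delta_le := h5
      abs_S_le := hS
      abs_S'_le := hS'
      eta_le := h6
      delta_le_eps := by linarith
      le_delta_mul := h8
      four_le := h9
      d_le := h10
      le_boundary := h11
      drift_le := by linarith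
      noise_le := hN
      noise_window := hW
      abs_V_le := hV }

/-- The standardized delay time as a real random variable, with the value `0` if the change is not
detected. -/
def realStandardizedDelay (M : MonitoringModel Ω) (P : Measure Ω) (m : ℕ) (ω : Ω) : ℝ :=
  if M.delayTime P m ω = ⊤ then 0
  else (((M.delayTime P m ω).toNat : ℝ) - M.a P m (M.S1 P m ω) (M.S1Star P m ω))
    / M.b P m (M.S1 P m ω) (M.S1Star P m ω)

/-- On a regular path the change is detected, and the standardized delay time is the negative of the
signed noise, up to a small error. -/
lemma delayTime_of_regularPath {m : ℕ} (hm : 0 < m) {ω : Ω} {V ε C δ : ℝ}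
    (h : RegularPath (M.kstar m) (M.S1 P m ω) (M.S1Star P m ω) (Real.sign (M.Delta P m)) (M.c m)
      (√(m : ℝ)) |M.Delta P m| V (fun k => M.noise P m k ω) ε C δ (M.approxDelay P m)) :
    M.delayTime P m ω ≠ ⊤ ∧ |M.realStandardizedDelay P m ω + V| ≤ 3 * ε := by
  obtain ⟨κ, ⟨hκ, hcross⟩, hmin, hdist⟩ := h.exists_first_crossing
  have hdelay : M.delayTime P m ω = (κ : ℕ∞) := by
    refine le_antisymm (iInf₂_le κ ⟨hκ, ?_⟩) (le_iInf₂ fun k hk => ?_)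
    · have h2 := hk.2
      rw [lt_weight_mul_iff hm, Gam_eq_detectorPath hm hk.1] at h2
      exact_mod_cast hmin k hk.1 h2
    · rw [lt_weight_mul_iff hm, Gam_eq_detectorPath hm hκ]
      exact hcross
  have hne : M.delayTime P m ω ≠ ⊤ := by rw [hdelay]; exact ENat.natCast_ne_top κ
  refine ⟨hne, ?_⟩
  rw [realStandardizedDelay, if_neg hne, hdelay, ENat.toNat_natCast]
  exact hdist

variable [IsProbabilityMeasure P]

/-- The noise of the detector is of the order `√approxDelay`, uniformly over all times up to twice
the approximate delay time. -/
lemma exists_noise_bound (hc : M.ChangeMagnitude P) (ht : M.ThresholdAssumptions P)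
    (hb : M.BeforeChange P) (ha : M.AfterChange P) {η : ℝ} (hη : 0 < η) :
    ∃ C : ℝ, 1 ≤ C ∧ ∀ᶠ m in atTop, P.real {ω | ∃ l : ℕ, (l : ℝ) ≤ 2 * M.approxDelay P m ∧
      C * √(M.approxDelay P m) < |M.preNoise P m ω + M.postNoise P m l ω|} ≤ η := by
  have hA := tendsto_approxDelay hc ht
  set k : ℕ → ℕ := fun m => ⌈2 * M.approxDelay P m⌉₊ with hk
  have hkt : Tendsto k atTop atTop :=
    tendsto_nat_ceil_atTop.comp (hA.const_mul_atTop two_pos)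
  obtain ⟨C₁, hC₁, h1⟩ := (hb.partial_sums k hkt).measureReal_max_sum_le hkt (by simp)
    (half_pos hη)
  obtain ⟨C₂, hC₂, h2⟩ := (ha.partial_sums k hkt).measureReal_max_sum_le hkt (by simp)
    (half_pos hη)
  refine ⟨2 * (C₁ + C₂) + 1, by linarith, ?_⟩
  filter_upwards [h1, h2, hA.eventually_ge_atTop 1, approxDelay_eq ht] with m e1 e2 e3 e4
  have hle : P.real {ω | ∃ l : ℕ, (l : ℝ) ≤ 2 * M.approxDelay P m ∧
      (2 * (C₁ + C₂) + 1) * √(M.approxDelay P m) < |M.preNoise P m ω + M.postNoise P m l ω|}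
      ≤ η / 2 + η / 2 := by
    refine (measureReal_mono ?_).trans ((measureReal_union_le _ _).trans (add_le_add e1 e2))
    rintro ω ⟨l, hl, hlt⟩
    by_contra hcon
    simp only [Set.mem_union, Set.mem_ofPred_eq, not_or, not_exists, not_and, not_lt] at hcon
    have hceil : 2 * M.approxDelay P m ≤ k m := Nat.le_ceil _
    have hks : M.kstar m ≤ k m := by
      have : (M.kstar m : ℝ) ≤ k m := by
        have : (0 : ℝ) ≤ M.approxLag P m := Nat.cast_nonneg _
        linarith [e4.1]
      exact_mod_cast this
    have c1 : |M.preNoise P m ω| ≤ _ := hcon.1 _ hks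
    have c2 : |M.postNoise P m l ω| ≤ _ := hcon.2 l (by exact_mod_cast hl.trans hceil)
    have hsq : √(k m : ℝ) ≤ 2 * √(M.approxDelay P m) := by
      have e5 : (k m : ℝ) ≤ 2 ^ 2 * M.approxDelay P m := by
        have := Nat.ceil_lt_add_one (by linarith : 0 ≤ 2 * M.approxDelay P m)
        simp only [hk]
        linarith
      refine (Real.sqrt_le_sqrt e5).trans ?_
      rw [Real.sqrt_mul (by norm_num), Real.sqrt_sq (by norm_num)]
    have c3 := abs_add_le (M.preNoise P m ω) (M.postNoise P m l ω)
    have c4 : C₁ * √(k m : ℝ) ≤ C₁ * (2 * √(M.approxDelay P m)) := by gcongr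
    have c5 : C₂ * √(k m : ℝ) ≤ C₂ * (2 * √(M.approxDelay P m)) := by gcongr
    have c6 := Real.sqrt_nonneg (M.approxDelay P m)
    linarith
  linarith

/-- The remainder terms of the detector are negligible. -/
lemma tendsto_remainder (hc : M.ChangeMagnitude P) (ht : M.ThresholdAssumptions P)
    (hb : M.BeforeChange P) (ha : M.AfterChange P) {ε : ℝ} (hε : 0 < ε) :
    Tendsto (fun m => P.real {ω | ∃ l : ℕ, (l : ℝ) ≤ 2 * M.approxDelay P m ∧
      ε * √(M.approxDelay P m) < |M.preRemainder P m ω + M.postRemainder P m l ω|})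
      atTop (𝓝 0) := by
  have hA := tendsto_approxDelay hc ht
  set n : ℕ → ℕ := fun m => ⌈2 * M.approxDelay P m⌉₊ with hn
  obtain ⟨p, hp⟩ := exists_approxDelay_le_pow hc
  have hnp : ∀ᶠ m : ℕ in atTop, (n m : ℝ) ≤ (m : ℝ) ^ p := by
    filter_upwards [hp, hA.eventually_ge_atTop 1] with m h1 h2
    have := Nat.ceil_lt_add_one (by linarith : 0 ≤ 2 * M.approxDelay P m)
    simp only [hn]
    linarith
  have hnA : ∀ᶠ m : ℕ in atTop, (n m : ℝ) ≤ 3 * M.approxDelay P m := by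
    filter_upwards [hA.eventually_ge_atTop 1] with m h2
    have := Nat.ceil_lt_add_one (by linarith : 0 ≤ 2 * M.approxDelay P m)
    simp only [hn]
    linarith
  have hn0 : ∀ᶠ m : ℕ in atTop, 0 < n m := by
    filter_upwards [hA.eventually_ge_atTop 1] with m h2
    exact Nat.ceil_pos.2 (by linarith)
  obtain ⟨u₁, hu₁, hu₁'⟩ := hb.remainder
  obtain ⟨u₂, hu₂, hu₂'⟩ := ha.remainder
  have l1 := tendsto_measureReal_max_remainder
    (f := fun _ i j ω => M.r P (M.Y (i : ℤ) ω) (M.Y (j : ℤ) ω))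
    (fun _ _ _ => measurable_r_comp _ _) hu₁ hu₁' (q := fun m => m) (fun m => le_rfl) hA hnp hnA
    hn0 (half_pos hε)
  have l2 := tendsto_measureReal_max_remainder
    (f := fun m i j ω => M.rStar P m (M.Y (i : ℤ) ω) (M.Z m (j : ℤ) ω))
    (fun _ _ _ => measurable_rStar_comp _ _ _) hu₂ hu₂' (q := fun m => m + M.kstar m)
    (fun m => Nat.le_add_right _ _) hA hnp hnA hn0 (half_pos hε)
  have hsum := l1.add l2
  rw [add_zero] at hsum
  refine squeeze_zero' (Eventually.of_forall fun _ => measureReal_nonneg) ?_ hsum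
  filter_upwards [hA.eventually_ge_atTop 1, approxDelay_eq ht] with m e3 e4
  refine (measureReal_mono ?_).trans (measureReal_union_le _ _)
  rintro ω ⟨l, hl, hlt⟩
  by_contra hcon
  simp only [Set.mem_union, Set.mem_ofPred_eq, not_or, not_exists, not_and, not_lt] at hcon
  have hceil : 2 * M.approxDelay P m ≤ n m := Nat.le_ceil _
  have hks : M.kstar m ≤ n m := by
    have : (M.kstar m : ℝ) ≤ n m := by
      have : (0 : ℝ) ≤ M.approxLag P m := Nat.cast_nonneg _
      linarith [e4.1]
    exact_mod_cast this
  have c1 : |M.preRemainder P m ω| ≤ _ := hcon.1 _ hks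
  have c2 : |M.postRemainder P m l ω| ≤ _ := hcon.2 l (by exact_mod_cast hl.trans hceil)
  have c3 := abs_add_le (M.preRemainder P m ω) (M.postRemainder P m l ω)
  linarith

/-- In the window around the approximate delay time the noise is nearly constant. -/
lemma tendsto_noise_window (hc : M.ChangeMagnitude P) (ht : M.ThresholdAssumptions P)
    (ha : M.AfterChange P) {ε : ℝ} (hε : 0 < ε) :
    Tendsto (fun m => P.real {ω | ∃ l : ℕ,
      |((M.kstar m + l : ℕ) : ℝ) - M.approxDelay P m| ≤ M.windowWidth P m * M.approxDelay P m ∧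
      ε * √(M.approxDelay P m) < |M.postNoise P m l ω - M.postNoise P m (M.approxLag P m) ω|})
      atTop (𝓝 0) := by
  have hA := tendsto_approxDelay hc ht
  set w : ℕ → ℕ := fun m => ⌈M.windowWidth P m * M.approxDelay P m + 1⌉₊ with hw
  have hwin : Tendsto (fun m => ((2 * w m : ℕ) : ℝ) / M.approxDelay P m) atTop (𝓝 0) := by
    have e1 : Tendsto (fun m => 2 * M.windowWidth P m + 4 * (M.approxDelay P m)⁻¹) atTop (𝓝 0) := by
      simpa using ((tendsto_windowWidth hc ht).const_mul 2).add
        ((tendsto_inv_atTop_zero.comp hA).const_mul 4)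
    refine squeeze_zero' ?_ ?_ e1
    · filter_upwards [hA.eventually_gt_atTop 0] with m h1
      positivity
    · filter_upwards [hA.eventually_gt_atTop 0, windowWidth_pos hc ht] with m h1 h2
      have h3 := Nat.ceil_lt_add_one
        (by positivity : 0 ≤ M.windowWidth P m * M.approxDelay P m + 1)
      rw [div_le_iff₀ h1, add_mul, mul_assoc 4, inv_mul_cancel₀ h1.ne']
      push_cast
      linarith
  -- all lags of the window are compared to its left end, which is lag `0` if the subtraction
  -- truncates
  have hlim := tendsto_window_Z ha (fun m => m + M.kstar m + (M.approxLag P m - w m)) hA hwin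
    (half_pos hε)
  refine squeeze_zero' (Eventually.of_forall fun _ => measureReal_nonneg) ?_ hlim
  filter_upwards [approxDelay_eq ht, hA.eventually_gt_atTop 0, windowWidth_pos hc ht]
    with m e4 hA0 hw0
  refine measureReal_mono ?_
  rintro ω ⟨l, hl, hlt⟩
  by_contra hcon
  simp only [Set.mem_ofPred_eq, not_exists, not_and, not_lt] at hcon
  have hceil : M.windowWidth P m * M.approxDelay P m + 1 ≤ w m := Nat.le_ceil _
  have hl' := abs_le.1 hl
  push_cast at hl'
  have hl1 : l ≤ M.approxLag P m + w m := by
    have : (l : ℝ) ≤ M.approxLag P m + w m := by linarith [e4.2]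
    exact_mod_cast this
  have hl2 : M.approxLag P m ≤ l + w m := by
    have : (M.approxLag P m : ℝ) ≤ l + w m := by linarith [e4.1]
    exact_mod_cast this
  have hpost : ∀ l', M.approxLag P m ≤ l' + w m → l' ≤ M.approxLag P m + w m →
      |M.postNoise P m l' ω - M.postNoise P m (M.approxLag P m - w m) ω|
        ≤ ε / 2 * √(M.approxDelay P m) := by
    intro l' h1 h2
    have h3 := hcon (l' - (M.approxLag P m - w m)) (by omega)
    have h4 := sum_Icc_add_add (fun j : ℕ => M.h2Star P m (M.Z m (j : ℤ) ω)) (m + M.kstar m)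
      (M.approxLag P m - w m) (l' - (M.approxLag P m - w m))
    have h5 : m + M.kstar m + (M.approxLag P m - w m) + (l' - (M.approxLag P m - w m))
        = m + M.kstar m + l' := by omega
    rw [h5] at h3 h4
    simp only [postNoise]
    rw [h4, add_sub_cancel_left]
    exact h3
  have b1 := abs_le.1 (hpost l hl2 hl1)
  have b2 := abs_le.1 (hpost (M.approxLag P m) (by omega) (by omega))
  refine absurd hlt (not_lt.2 (abs_le.2 ⟨?_, ?_⟩)) <;> linarith

/-- With high probability the change is detected and the standardized delay time is close to the
negative of the signed normalized noise. -/
theorem tendsto_measureReal_standardizedDelay_far (hc : M.ChangeMagnitude P)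
    (ht : M.ThresholdAssumptions P) (hb : M.BeforeChange P) (ha : M.AfterChange P)
    {ε : ℝ} (hε : 0 < ε) (hε1 : ε ≤ 1) :
    Tendsto (fun m => P.real {ω | ¬ (M.delayTime P m ω ≠ ⊤ ∧
      |M.realStandardizedDelay P m ω + Real.sign (M.Delta P m) * M.normalizedNoise P m ω| ≤ 3 * ε)})
      atTop (𝓝 0) := by
  have hA := tendsto_approxDelay hc ht
  rw [Metric.tendsto_atTop]
  intro η hη
  rw [← eventually_atTop]
  have hη6 : 0 < η / 6 := by positivity
  obtain ⟨C₁, hC₁⟩ := ht.S1_bounded (η / 6) hη6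
  obtain ⟨C₂, hC₂⟩ := ht.S1Star_bounded (η / 6) hη6
  obtain ⟨C₃, hC₃1, hC₃⟩ := exists_noise_bound hc ht hb ha hη6
  set C := max (C₃ + 1) (max C₁ C₂) with hC
  have hC1 : C₁ ≤ C := (le_max_left _ _).trans (le_max_right _ _)
  have hC2 : C₂ ≤ C := (le_max_right _ _).trans (le_max_right _ _)
  have hC3 : C₃ + 1 ≤ C := le_max_left _ _
  have hR := (tendsto_remainder hc ht hb ha (by positivity : 0 < ε / 8)).eventually
    (gt_mem_nhds hη6)
  have hWn := (tendsto_noise_window hc ht ha (by positivity : 0 < ε / 8)).eventually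
    (gt_mem_nhds hη6)
  have hwle := (tendsto_windowWidth hc ht).eventually
    (ge_mem_nhds (by norm_num : (0 : ℝ) < 1 / 2))
  filter_upwards [hC₁, hC₂, hC₃, hR, hWn, hA.eventually_ge_atTop 1, approxDelay_eq ht,
    eventually_gt_atTop 0, hc.abs_Delta_pos, hwle,
    eventually_regularPath hc ht hε hε1 (by linarith : 1 ≤ C)]
    with m p1 p2 p3 p4 p5 e1 e2 e3 e4 e5 hreg
  rw [Real.dist_eq, sub_zero, abs_of_nonneg measureReal_nonneg]
  have hs : 0 < √(M.approxDelay P m) := Real.sqrt_pos.2 (by linarith)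
  set E₁ := {ω | C₁ < |M.S1 P m ω|}
  set E₂ := {ω | C₂ < |M.S1Star P m ω|}
  set E₃ := {ω | ∃ l : ℕ, (l : ℝ) ≤ 2 * M.approxDelay P m ∧
      C₃ * √(M.approxDelay P m) < |M.preNoise P m ω + M.postNoise P m l ω|}
  set E₄ := {ω | ∃ l : ℕ, (l : ℝ) ≤ 2 * M.approxDelay P m ∧
      ε / 8 * √(M.approxDelay P m) < |M.preRemainder P m ω + M.postRemainder P m l ω|}
  set E₅ := {ω | ∃ l : ℕ,
      |((M.kstar m + l : ℕ) : ℝ) - M.approxDelay P m| ≤ M.windowWidth P m * M.approxDelay P m ∧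
      ε / 8 * √(M.approxDelay P m)
        < |M.postNoise P m l ω - M.postNoise P m (M.approxLag P m) ω|}
  have hsub : {ω | ¬ (M.delayTime P m ω ≠ ⊤ ∧ |M.realStandardizedDelay P m ω
      + Real.sign (M.Delta P m) * M.normalizedNoise P m ω| ≤ 3 * ε)}
      ⊆ E₁ ∪ (E₂ ∪ (E₃ ∪ (E₄ ∪ E₅))) := by
    intro ω hω
    by_contra hcon
    simp only [Set.mem_union, not_or] at hcon
    obtain ⟨g1, g2, g3, g4, g5⟩ := hcon
    simp only [E₁, E₂, E₃, E₄, E₅, Set.mem_ofPred_eq, not_exists, not_and, not_lt]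
      at g1 g2 g3 g4 g5
    refine hω (delayTime_of_regularPath (C := C) (δ := M.windowWidth P m) e3
      (hreg _ _ _ _ (g1.trans hC1) (g2.trans hC2) ?_ ?_ ?_))
    all_goals
      have hsign : |Real.sign (M.Delta P m)| = 1 := by
        rcases Real.sign_apply_eq_of_ne_zero _ (abs_pos.1 e4) with h | h <;> rw [h] <;> simp
    · have hlag : (M.approxLag P m : ℝ) ≤ 2 * M.approxDelay P m := by
        have : (0 : ℝ) ≤ M.kstar m := Nat.cast_nonneg _
        linarith [e2.1]
      rw [abs_mul, hsign, one_mul, normalizedNoise, abs_div, abs_of_pos hs, div_le_iff₀ hs]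
      refine (g3 _ hlag).trans ?_
      gcongr
      linarith
    · intro k hk hkA
      obtain ⟨l, rfl⟩ := Nat.exists_eq_add_of_le hk.le
      have hl : (l : ℝ) ≤ 2 * M.approxDelay P m := by
        push_cast at hkA
        linarith [(M.kstar m).cast_nonneg (α := ℝ)]
      have i1 := g3 l hl
      have i2 := g4 l hl
      simp only [noise, Nat.add_sub_cancel_left]
      refine (abs_add_le _ _).trans ((add_le_add i1 i2).trans ?_)
      rw [← add_mul]
      gcongr
      linarith
    · intro k hk hkA
      obtain ⟨l, rfl⟩ := Nat.exists_eq_add_of_le hk.le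
      have hl : (l : ℝ) ≤ 2 * M.approxDelay P m := by
        have h1 := (abs_le.1 hkA).2
        push_cast at h1
        have h2 : M.windowWidth P m * M.approxDelay P m ≤ 1 / 2 * M.approxDelay P m := by gcongr
        linarith [(M.kstar m).cast_nonneg (α := ℝ)]
      have i1 := g5 l hkA
      have i2 := g4 l hl
      simp only [noise, Nat.add_sub_cancel_left]
      have e : Real.sign (M.Delta P m) * (M.preNoise P m ω + M.postNoise P m l ω
          + (M.preRemainder P m ω + M.postRemainder P m l ω))
          - Real.sign (M.Delta P m) * M.normalizedNoise P m ω * √(M.approxDelay P m)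
          = Real.sign (M.Delta P m) *
            ((M.postNoise P m l ω - M.postNoise P m (M.approxLag P m) ω)
            + (M.preRemainder P m ω + M.postRemainder P m l ω)) := by
        rw [normalizedNoise]
        field_simp
        ring
      rw [e, abs_mul, hsign, one_mul]
      refine (abs_add_le _ _).trans ((add_le_add i1 i2).trans (le_of_eq ?_))
      ring
  have hunion : P.real (E₁ ∪ (E₂ ∪ (E₃ ∪ (E₄ ∪ E₅))))
      ≤ P.real E₁ + (P.real E₂ + (P.real E₃ + (P.real E₄ + P.real E₅))) := by
    refine (measureReal_union_le _ _).trans (add_le_add le_rfl ?_)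
    refine (measureReal_union_le _ _).trans (add_le_add le_rfl ?_)
    refine (measureReal_union_le _ _).trans (add_le_add le_rfl ?_)
    exact measureReal_union_le _ _
  have := measureReal_mono (μ := P) hsub
  linarith

end GoodEvents

end MonitoringModel

namespace MonitoringModel

/-! ### Measurability of the delay time -/

section DelayMeasurability

variable {Ω : Type*} [MeasurableSpace Ω] {M : MonitoringModel Ω} {P : Measure Ω}

lemma measurable_X (m i : ℕ) : Measurable (M.X m i) := by
  unfold X
  by_cases h : i ≤ M.kstar m + m
  · simpa only [h, if_true] using M.measurable_Y i
  · simpa only [h, if_false] using M.measurable_Z m i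

lemma measurable_Gam (m k : ℕ) : Measurable (M.Gam P m k) :=
  (Finset.measurable_sum _ fun i _ => Finset.measurable_sum _ fun j _ =>
    (M.measurable_h.comp ((measurable_X m i).prodMk (measurable_X m j))).sub_const _).const_mul _

lemma measurableSet_le_delayTime (m : ℕ) (y : ℕ∞) :
    MeasurableSet {ω | y ≤ M.delayTime P m ω} := by
  have : {ω | y ≤ M.delayTime P m ω} = ⋂ k : ℕ,
      {ω | (M.kstar m < k ∧ M.c m < weight m k * |M.Gam P m k ω|) → y ≤ (k : ℕ∞)} := by
    ext ω
    simp only [delayTime, le_iInf_iff, Set.mem_ofPred_eq, Set.mem_iInter]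
  rw [this]
  refine MeasurableSet.iInter fun k => ?_
  have hcross : MeasurableSet {ω | M.kstar m < k ∧ M.c m < weight m k * |M.Gam P m k ω|} :=
    (MeasurableSet.const _).inter
      (measurableSet_lt measurable_const ((measurable_Gam m k).abs.const_mul _))
  exact hcross.imp (MeasurableSet.const _)

lemma measurable_delayTime (m : ℕ) : Measurable (M.delayTime P m) := by
  refine measurable_to_countable' fun x => ?_
  rcases eq_or_ne x ⊤ with rfl | hx
  · have : M.delayTime P m ⁻¹' {⊤} = {ω | ⊤ ≤ M.delayTime P m ω} := by
      ext ω
      simp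
    rw [this]
    exact measurableSet_le_delayTime m ⊤
  · have : M.delayTime P m ⁻¹' {x}
        = {ω | x ≤ M.delayTime P m ω} \ {ω | x + 1 ≤ M.delayTime P m ω} := by
      ext ω
      simp only [Set.mem_preimage, Set.mem_singleton_iff, Set.mem_sdiff, Set.mem_ofPred_eq,
        ENat.add_one_le_iff hx, not_lt]
      exact ⟨fun h => ⟨h.ge, h.le⟩, fun h => le_antisymm h.2 h.1⟩
    rw [this]
    exact (measurableSet_le_delayTime m _).diff (measurableSet_le_delayTime m _)

lemma measurableSet_delayTime_top (m : ℕ) : MeasurableSet {ω | M.delayTime P m ω = ⊤} :=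
  measurable_delayTime m (MeasurableSet.singleton ⊤)

variable [IsProbabilityMeasure P]

lemma measurable_S1 (m : ℕ) : Measurable (M.S1 P m) := by
  have h : ∀ i : ℕ, Measurable fun ω => M.h1 P (M.Y i ω) := fun i =>
    measurable_h1.comp (M.measurable_Y i)
  exact (Finset.measurable_sum _ fun i _ => h i).const_mul _

lemma measurable_S1Star (m : ℕ) : Measurable (M.S1Star P m) := by
  have h : ∀ i : ℕ, Measurable fun ω => M.h1Star P m (M.Y i ω) := fun i =>
    (measurable_h1Star m).comp (M.measurable_Y i)
  exact (Finset.measurable_sum _ fun i _ => h i).const_mul _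

lemma measurable_a (m : ℕ) : Measurable fun ω => M.a P m (M.S1 P m ω) (M.S1Star P m ω) := by
  have h1 := measurable_S1 (M := M) (P := P) m
  have h2 := measurable_S1Star (M := M) (P := P) m
  unfold a
  fun_prop

lemma measurable_ratio (m : ℕ) : Measurable fun ω =>
    (((M.delayTime P m ω).toNat : ℝ) - M.a P m (M.S1 P m ω) (M.S1Star P m ω))
      / M.b P m (M.S1 P m ω) (M.S1Star P m ω) := by
  have h1 : Measurable fun ω => ((M.delayTime P m ω).toNat : ℝ) :=
    (measurable_of_countable fun x : ℕ∞ => (x.toNat : ℝ)).comp (measurable_delayTime m)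
  have h2 := measurable_a (M := M) (P := P) m
  exact (h1.sub h2).div (h2.sqrt.div_const _)

lemma measurable_realStandardizedDelay (m : ℕ) : Measurable (M.realStandardizedDelay P m) :=
  Measurable.ite (measurableSet_delayTime_top m) measurable_const (measurable_ratio m)

lemma measurable_standardizedDelay (m : ℕ) : Measurable (M.standardizedDelay P m) :=
  Measurable.ite (measurableSet_delayTime_top m) measurable_const
    (measurable_coe_real_ereal.comp (measurable_ratio m))

end DelayMeasurability

end MonitoringModel

/-- Convergence in distribution is not affected by changes on events of vanishing probability. -/
lemma TendstoInDistribution.congr_of_measureReal_ne {Ω E Ω' : Type*} [MeasurableSpace Ω]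
    {P : Measure Ω} [IsProbabilityMeasure P] [TopologicalSpace E] [MeasurableSpace E]
    [BorelSpace E] [MeasurableSpace Ω'] {P' : Measure Ω'} [IsProbabilityMeasure P']
    {X Y : ℕ → Ω → E} {Z : Ω' → E}
    (h : TendstoInDistribution X atTop Z (fun _ => P) P') (hY : ∀ m, AEMeasurable (Y m) P)
    (hXY : Tendsto (fun m => P.real {ω | X m ω ≠ Y m ω}) atTop (𝓝 0)) :
    TendstoInDistribution Y atTop Z (fun _ => P) P' := by
  have hX := h.forall_aemeasurable
  have hZ := h.aemeasurable_limit
  rw [tendstoInDistribution_iff_integral hX hZ] at h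
  rw [tendstoInDistribution_iff_integral hY hZ]
  intro F
  have hint : ∀ {V : ℕ → Ω → E}, (∀ m, AEMeasurable (V m) P) → ∀ m,
      Integrable (fun ω => F (V m ω)) P := fun hV m =>
    Integrable.of_bound (F.continuous.measurable.comp_aemeasurable (hV m)).aestronglyMeasurable ‖F‖
      (Eventually.of_forall fun ω => F.norm_coe_le_norm _)
  have hdiff : Tendsto (fun m => ∫ ω, (F (Y m ω) - F (X m ω)) ∂P) atTop (𝓝 0) := by
    refine squeeze_zero_norm (a := fun m => 2 * ‖F‖ * P.real {ω | X m ω ≠ Y m ω}) (fun m => ?_)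
      (by simpa using hXY.const_mul (2 * ‖F‖))
    set T := toMeasurable P {ω | X m ω ≠ Y m ω} with hT
    have hTm : MeasurableSet T := measurableSet_toMeasurable _ _
    have hTP : P.real T = P.real {ω | X m ω ≠ Y m ω} := by
      rw [measureReal_def, measureReal_def, hT, measure_toMeasurable]
    have hzero : ∀ ω, ω ∉ T → F (Y m ω) - F (X m ω) = 0 := by
      intro ω hω
      have : X m ω = Y m ω := by
        by_contra hne
        exact hω (subset_toMeasurable _ _ hne)
      rw [this, sub_self]
    rw [← setIntegral_eq_integral_of_forall_compl_eq_zero hzero, ← hTP]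
    refine norm_setIntegral_le_of_norm_le_const (measure_lt_top _ _) fun ω _ => ?_
    have := norm_sub_le (F (Y m ω)) (F (X m ω))
    linarith [F.norm_coe_le_norm (Y m ω), F.norm_coe_le_norm (X m ω)]
  have := (h F).add hdiff
  rw [add_zero] at this
  refine this.congr fun m => ?_
  rw [integral_sub (hint hY m) (hint hX m)]
  ring

theorem mainTheorem3 {Ω : Type*} [MeasurableSpace Ω] (P : Measure Ω) [IsProbabilityMeasure P]
    (M : MonitoringModel Ω) (σ τ : ℝ) (D : ℝ≥0∞)
    (hint : M.KernelIntegrable P)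
    (hchange : M.ChangeMagnitude P)
    (hbefore : M.BeforeChange P)
    (hindep : M.MonitoringIndependent P)
    (hafter : M.AfterChange P)
    (hD : Tendsto (fun m : ℕ =>
        ENNReal.ofReal ((m : ℝ) ^ (M.beta - 1) * (√(m : ℝ) * |M.Delta P m| / M.c m)))
      atTop (𝓝 D))
    (hearly : D ≠ ⊤ → M.VeryEarlyChange P σ τ)
    (hlater : D = ⊤ → M.LaterChange P σ)
    (hthreshold : M.ThresholdAssumptions P) :
    TendstoInDistribution (fun (m : ℕ) ω => M.standardizedDelay P m ω) atTop
      (fun x : ℝ => (x : EReal)) (fun _ => P)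
      (gaussianReal 0 (M.limitVariance σ τ D).toNNReal) := by
  have hprop := MonitoringModel.tendsto_kstar_div_approxDelay hchange hthreshold hD
  have hnoise : TendstoInDistribution (M.normalizedNoise P) atTop (id : ℝ → ℝ) (fun _ => P)
      (gaussianReal 0 (M.limitVariance σ τ D).toNNReal) := by
    rw [MonitoringModel.limitVariance_eq]
    by_cases hDt : D = ⊤
    · have h1 : M.limitProportion D = 1 := if_pos hDt
      rw [h1] at hprop ⊢
      simpa using MonitoringModel.tendstoInDistribution_normalizedNoise_of_later hchange hthreshold
        hbefore hafter (hlater hDt) hprop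
    · exact MonitoringModel.tendstoInDistribution_normalizedNoise_of_early hchange hthreshold
        hbefore hafter (hearly hDt) (M.limitProportion_mem D) hprop
  have hsigned := TendstoInDistribution.sign_mul hnoise
    (s := fun m => -Real.sign (M.Delta P m)) (by
      filter_upwards [hchange.abs_Delta_pos] with m hm
      rcases Real.sign_apply_eq_of_ne_zero _ (abs_pos.1 hm) with h | h <;> rw [h] <;> simp)
  have hreal : TendstoInDistribution (M.realStandardizedDelay P) atTop (id : ℝ → ℝ) (fun _ => P)
      (gaussianReal 0 (M.limitVariance σ τ D).toNNReal) := by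
    refine tendstoInDistribution_of_tendstoInMeasure_sub _ _ hsigned
      (tendstoInMeasure_zero_of_measureReal fun ε hε => ?_)
      fun m => (MonitoringModel.measurable_realStandardizedDelay m).aemeasurable
    have hε' : 0 < min (ε / 3) 1 := lt_min (by positivity) one_pos
    refine squeeze_zero (fun _ => measureReal_nonneg) (fun m => measureReal_mono ?_)
      (MonitoringModel.tendsto_measureReal_standardizedDelay_far hchange hthreshold hbefore hafter
        hε' (min_le_right _ _))
    intro ω hω hcon
    have h1 := hcon.2
    simp only [Set.mem_ofPred_eq, Pi.sub_apply, neg_mul, sub_neg_eq_add] at hω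
    linarith [min_le_left (ε / 3) 1]
  have hcoe : TendstoInDistribution (fun m ω => (M.realStandardizedDelay P m ω : EReal)) atTop
      (fun x : ℝ => (x : EReal)) (fun _ => P)
      (gaussianReal 0 (M.limitVariance σ τ D).toNNReal) :=
    TendstoInDistribution.continuous_comp (g := Real.toEReal) continuous_coe_real_ereal hreal
  refine TendstoInDistribution.congr_of_measureReal_ne hcoe
    (fun m => (MonitoringModel.measurable_standardizedDelay m).aemeasurable) ?_
  refine squeeze_zero (fun _ => measureReal_nonneg) (fun m => measureReal_mono ?_)
    (MonitoringModel.tendsto_measureReal_standardizedDelay_far hchange hthreshold hbefore hafter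
      one_pos le_rfl)
  intro ω hω hcon
  refine hω ?_
  simp only [MonitoringModel.realStandardizedDelay, MonitoringModel.standardizedDelay,
    if_neg hcon.1]

end
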